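/- Let $\mathcal B$ be a Bayesian network (BN) on a finite set $V$ of random variables with finitely many values: a directed acyclic graph with a conditional probability table $P(v\mid Pa(v))$ for every $v\in V$. Call a variable \emph{internal} if it has a child, and assume that every internal variable has at least two values. Fix a topological order $\prec$ of $\mathcal B$. The \emph{moral closure} $\mathcal B^c$ is the directed graph obtained from $\mathcal B$ by iteratively adding an edge $(a,b)$ for all non-adjacent $a\prec b$ with a common child. \emph{Compilation (BN2SPN).} Let $M$ be a set of internal variables. Variable elimination in the reverse of the order $\prec$, applied to the indicators $\lambda_{v=x}$ and the symbolic parameters $\theta_{x\mid p}$ (the value $x$ of $v$ given the values $p$ of its parents), yields an arithmetic circuit with one node per table entry. The parameters are then moved to the weights of the sum nodes, which gives a sum-product network (SPN), and the variables in $M$ are marginalized by setting their indicators to $1$. Finally, the following three operations are repeated until nothing changes: every sum node with only indicator children becomes a terminal node (a univariate leaf distribution); every product node with only product children becomes the product of their children; product nodes with the same children are lumped. \emph{Decompilation (SPN2BN).} The sum-depth of a sum node $S$ is the largest number of sum nodes, $S$ excluded, on a path from the root to $S$; a sum-region is the set of all sum nodes with the same sum-depth and the same scope. The variables of the output are one latent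 variable per sum-region, and the observed variables, i.e. those of the leaves. In the augmented SPN, the edge from a sum $S$ to its child $C$ is replaced by an edge from $S$ to a new product of $C$, of the indicator that the latent variable $Z_S$ of $S$ selects $C$, and of the twin $\bar T$ (a sum over the indicators of $Z_T$) of every sum $T$ that is a proper descendant of $S$ and is not reached from $C$. A sum $S$ that is a proper ancestor of a node $N$ is conditioning for $N$ if, in the augmented SPN, not all children of $S$ reach the same subset of $\{N,\bar N\}$ (a leaf has no twin). For every sum or leaf $N$ and every conditioning sum $S$ of $N$, the output has an edge from the latent variable of the region of $S$ to the variable of $N$. \textbf{Theorem.} The compilation terminates. Let $\mathcal D$ be the output of SPN2BN on the compiled SPN. Name every observed variable of $\mathcal D$ by itself, and every latent variable of $\mathcal D$ by the variable $v$ whose elimination created the sum nodes of its region; this name is well defined. (a) If $M$ is the set of all internal variables, then the naming is an isomorphism from $\mathcal D$ onto the moral closure $\mathcal B^c$. (b) For an arbitrary set $M$ of internal variables, the naming is onto $V$, and for all $u,v\in V$, $(u,v)$ is an edge of $\mathcal B^c$ if and only if $u\neq v$ and $\mathcal D$ has an edge from a variable named $u$ to a variable named $v$; that is, $\mathcal D$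 becomes $\mathcal B^c$ when variables with the same name are identified. More precisely, the observed variables of $\mathcal D$ are those in $V\setminus M$; there is exactly one latent variable $Z_v$ for each internal $v$ and no other one; on the latent variables and the observed variables that are not internal, the edges of $\mathcal D$ are exactly those of $\mathcal B^c$; every internal $v\notin M$ has $Z_v$ as its only parent; and no observed variable has a child in $\mathcal D$. -/

import Mathlib

namespace SPN

universe u w

/-! ## Bayesian networks and the moral closure -/

/-- A Bayesian network over the finite set `V` of random variables, the variable `v` taking its
values in the finite type `Val v`: a directed acyclic graph and, for every variable, a conditional
probability table given its parents. -/
structure BayesNet (V : Type u) (Val : V → Type w) [∀ v, Fintype (Val v)] where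
  dag : Digraph V
  acyclic : ∀ v, ¬ Relation.TransGen dag.Adj v v
  /-- `cpt v x p` is `P(v = x | Pa(v) = p)`. -/
  cpt : ∀ v, Val v → (∀ p : {p // dag.Adj p v}, Val p) → ℝ
  cpt_nonneg : ∀ v x p, 0 ≤ cpt v x p
  cpt_sum : ∀ v p, ∑ x, cpt v x p = 1

/-- The order of `V` is a topological order of the network. -/
def BayesNet.IsTopological {V : Type u} [LinearOrder V] {Val : V → Type w} [∀ v, Fintype (Val v)]
    (B : BayesNet V Val) : Prop :=
  ∀ p v, B.dag.Adj p v → p < v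

/-- An internal variable: one that has a child. -/
def BayesNet.Internal {V : Type u} {Val : V → Type w} [∀ v, Fintype (Val v)]
    (B : BayesNet V Val) (v : V) : Prop :=
  ∃ c, B.dag.Adj v c

/-- One round of moralization: all the edges `(a, b)` with `a < b` between two non-adjacent
vertices with a common child are added. -/
def moralStep {V : Type u} [LinearOrder V] (G : Digraph V) : Digraph V where
  Adj a b := G.Adj a b ∨
    (a < b ∧ ¬ G.Adj a b ∧ ¬ G.Adj b a ∧ ∃ c, G.Adj a c ∧ G.Adj b c)

/-- The moral closure: directed moralization edges are added iteratively. -/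
def moralClosure {V : Type u} [LinearOrder V] (G : Digraph V) : Digraph V where
  Adj a b := ∃ k : ℕ, (moralStep^[k] G).Adj a b

/-! ## Circuits -/

/-- What a node of a circuit is labelled with. `N` is the set of nodes. -/
inductive Op {V : Type u} (Val : V → Type w) (N : Type*) where
  /-- the indicator of `v = x` -/
  | indicator (v : V) (x : Val v) : Op Val N
  /-- a numeric constant -/
  | param (r : ℝ) : Op Val N
  /-- a univariate distribution of the variable `v` -/
  | terminal (v : V) (p : Val v → ℝ) : Op Val N
  /-- a weighted sum of its children -/
  | sum (ch : Multiset (ℝ × N)) : Op Val N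
  /-- the product of its children -/
  | prod (ch : Multiset N) : Op Val N

/-- A rooted circuit. The circuit proper consists of the nodes that can be reached from the root;
other elements of `N` are ignored. An arithmetic circuit has no terminal nodes and unit weights,
a sum-product network has no numeric constants. -/
structure Circuit {V : Type u} (Val : V → Type w) (N : Type*) where
  root : N
  op : N → Op Val N

namespace Circuit

variable {V : Type u} {Val : V → Type w} {N : Type*}

/-- `c` is a child of `n`. -/
def IsChild (C : Circuit Val N) (n c : N) : Prop :=
  match C.op n with
  | .sum ch => ∃ r, (r, c) ∈ ch
  | .prod ch => c ∈ ch
  | _ => False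

/-- There is a directed path, possibly of length zero, from `n` to `m`. -/
def Reach (C : Circuit Val N) : N → N → Prop := Relation.ReflTransGen C.IsChild

/-- `a` is a proper ancestor of `n`. -/
def IsAncestor (C : Circuit Val N) (a n : N) : Prop := Relation.TransGen C.IsChild a n

/-- The nodes of the circuit. -/
def Live (C : Circuit Val N) (n : N) : Prop := C.Reach C.root n

def IsSum (C : Circuit Val N) (n : N) : Prop := ∃ ch, C.op n = .sum ch

def IsProd (C : Circuit Val N) (n : N) : Prop := ∃ ch, C.op n = .prod ch

def IsParam (C : Circuit Val N) (n : N) : Prop := ∃ r, C.op n = .param r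

/-- `n` is a leaf distribution (an indicator or a terminal node) of the variable `v`. -/
def IsLeafOf (C : Circuit Val N) (v : V) (n : N) : Prop :=
  (∃ x, C.op n = .indicator v x) ∨ (∃ p, C.op n = .terminal v p)

/-- Two circuits on the same set of nodes are the same labelled graph. -/
def Same (C D : Circuit Val N) : Prop :=
  C.root = D.root ∧ ∀ n, C.Live n → C.op n = D.op n

/-! ### From arithmetic circuits to sum-product networks -/

/-- The value of a numeric constant, and `1` for every other node. -/
noncomputable def paramValue (C : Circuit Val N) (n : N) : ℝ :=
  match C.op n with
  | .param r => r
  | _ => 1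

open Classical in
/-- The edge `(r, c)` from a sum to its summand `c` after the constant factors of `c` have been
moved to the weight. If a product retains one factor only, the edge leads to that factor. -/
noncomputable def redistributeEdge (C : Circuit Val N) (e : ℝ × N) : ℝ × N :=
  match C.op e.2 with
  | .prod ch =>
      (e.1 * (ch.map C.paramValue).prod,
        if h : ∃ m, ch.filter (fun n => ¬ C.IsParam n) = {m} then h.choose else e.2)
  | _ => e

open Classical in
/-- Parameter redistribution: the constant factors of the summands of the sum nodes become the
weights of the sum nodes. -/
noncomputable def redistribute (C : Circuit Val N) : Circuit Val N where
  root := C.root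
  op n :=
    match C.op n with
    | .sum ch => .sum (ch.map C.redistributeEdge)
    | .prod ch => .prod (ch.filter fun m => ¬ C.IsParam m)
    | o => o

open Classical in
/-- Marginalization of the variables in `M`: their indicators are set to `1`, and these factors
are dropped from the products. -/
noncomputable def marginalize (M : Set V) (C : Circuit Val N) : Circuit Val N where
  root := C.root
  op n :=
    match C.op n with
    | .indicator v x => if v ∈ M then .param 1 else .indicator v x
    | .prod ch => .prod (ch.filter fun m => ¬ ∃ v ∈ M, ∃ x, C.op m = .indicator v x)
    | o => o

/-! ### Simplification -/

open Classical in
/-- A sum node all of whose children are indicators (of one variable) becomes a terminal node: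
the distribution of that variable given by the weights. -/
noncomputable def addTerminals (C : Circuit Val N) : Circuit Val N where
  root := C.root
  op n :=
    match C.op n with
    | .sum ch =>
        if h : ch ≠ 0 ∧ ∃ v, ∀ e ∈ ch, ∃ x, C.op e.2 = .indicator v x then
          .terminal h.2.choose fun x =>
            ((ch.filter fun e => C.op e.2 = .indicator h.2.choose x).map Prod.fst).sum
        else .sum ch
    | o => o

/-- The factors of a product node. -/
def factors (C : Circuit Val N) (n : N) : Multiset N :=
  match C.op n with
  | .prod ch => ch
  | _ => 0

open Classical in
/-- A product node all of whose children are products becomes the product of their children. -/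
noncomputable def removeProductsOfProducts (C : Circuit Val N) : Circuit Val N where
  root := C.root
  op n :=
    match C.op n with
    | .prod ch => if ∀ m ∈ ch, C.IsProd m then .prod (ch.bind C.factors) else .prod ch
    | o => o

open Classical in
/-- The node that a node is lumped into: the product nodes with the same children share one
representative, which is one of them, and every other node represents itself. -/
noncomputable def rep (C : Circuit Val N) (n : N) : N :=
  if C.Live n ∧ C.IsProd n then
    @Classical.epsilon N ⟨n⟩ (fun m => C.Live m ∧ C.op m = C.op n)
  else n

/-- Product nodes with the same children are lumped into one node. -/
noncomputable def lumpProducts (C : Circuit Val N) : Circuit Val N where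
  root := C.rep C.root
  op n :=
    match C.op n with
    | .sum ch => .sum (ch.map fun e => (e.1, C.rep e.2))
    | .prod ch => .prod (ch.map C.rep)
    | o => o

/-- The body of the simplification loop. -/
noncomputable def simplifyPass (C : Circuit Val N) : Circuit Val N :=
  C.addTerminals.removeProductsOfProducts.lumpProducts

/-- The loop that repeats `simplifyPass` until nothing changes, started at the first argument,
ends and returns the second one. -/
inductive Simplifies : Circuit Val N → Circuit Val N → Prop
  | unchanged (C : Circuit Val N) : Same C.simplifyPass C → Simplifies C C.simplifyPass
  | changed (C D : Circuit Val N) : ¬ Same C.simplifyPass C → Simplifies C.simplifyPass D →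
      Simplifies C D

end Circuit

/-! ## Compilation by variable elimination -/

/-- The nodes of the arithmetic circuits that variable elimination builds. They are expressions in
the indicators and in the (symbolic) parameters of the network; equal expressions are one and the
same node, so that a table entry which is used several times is shared. -/
inductive ACNode {V : Type u} (Val : V → Type w) (G : Digraph V) : Type (max u w) where
  | indicator (v : V) (x : Val v) : ACNode Val G
  /-- the parameter of `v = x` given that the parents of `v` have the values `p` -/
  | param (v : V) (x : Val v) (p : ∀ q : {q // G.Adj q v}, Val q) : ACNode Val G
  /-- a sum over the values of `v` -/
  | sumOver (v : V) (f : Val v → ACNode Val G) : ACNode Val G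
  | prodOf (n : ℕ) (f : Fin n → ACNode Val G) : ACNode Val G

/-- A symbolic factor: a table of circuit nodes indexed by the values of the variables in
`scope`. -/
structure Factor {V : Type u} (Val : V → Type w) (G : Digraph V) where
  scope : Finset V
  entry : (∀ v, Val v) → ACNode Val G
  entry_congr : ∀ x y, (∀ v ∈ scope, x v = y v) → entry x = entry y

namespace Factor

variable {V : Type u} {Val : V → Type w}

/-- The factor of the indicators of `v`. -/
def ofIndicator (G : Digraph V) (v : V) : Factor Val G where
  scope := {v}
  entry x := .indicator v (x v)
  entry_congr x y h := by rw [h v (by simp)]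

open Classical in
/-- The factor of the conditional probability table of `v`. -/
noncomputable def ofCPT [Fintype V] (G : Digraph V) (v : V) : Factor Val G where
  scope := Finset.univ.filter fun q => q = v ∨ G.Adj q v
  entry x := .param v (x v) fun q => x q
  entry_congr x y h := by
    have h1 : x v = y v := h v (by simp)
    have h2 : (fun q : {q // G.Adj q v} => x q) =
        fun q : {q // G.Adj q v} => y q := by
      funext q
      exact h q (by simp [q.2])
    rw [h1, h2]

/-- The entry of the product of a list of factors. -/
def mulEntry {G : Digraph V} (fs : List (Factor Val G)) (x : ∀ v, Val v) : ACNode Val G :=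
  .prodOf fs.length fun i => (fs.get i).entry x

open Classical in
/-- The factors `fs` are multiplied and `v` is summed out. -/
noncomputable def sumOut [Fintype V] {G : Digraph V} (v : V) (fs : List (Factor Val G)) :
    Factor Val G where
  scope := Finset.univ.filter fun q => q ≠ v ∧ ∃ φ ∈ fs, q ∈ φ.scope
  entry x := .sumOver v fun a => mulEntry fs (Function.update x v a)
  entry_congr x y h := by
    congr 1
    funext a
    unfold mulEntry
    congr 1
    funext i
    apply Factor.entry_congr
    intro q hq
    by_cases hqv : q = v
    · subst hqv
      simp
    · rw [Function.update_of_ne hqv, Function.update_of_ne hqv]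
      exact h q (Finset.mem_filter.2
        ⟨Finset.mem_univ _, hqv, fs.get i, List.get_mem fs i, hq⟩)

open Classical in
/-- One step of variable elimination: the factors that mention `v` are replaced by their product
with `v` summed out. -/
noncomputable def eliminate [Fintype V] {G : Digraph V} (fs : List (Factor Val G)) (v : V) :
    List (Factor Val G) :=
  sumOut v (fs.filter fun φ => v ∈ φ.scope) :: fs.filter fun φ => v ∉ φ.scope

end Factor

/-- The label of a node of an arithmetic circuit. -/
def ACNode.op {V : Type u} {Val : V → Type w} [∀ v, Fintype (Val v)] (B : BayesNet V Val) :
    ACNode Val B.dag → Op Val (ACNode Val B.dag)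
  | .indicator v x => .indicator v x
  | .param v x p => .param (B.cpt v x p)
  | .sumOver _ f => .sum (Finset.univ.val.map fun x => (1, f x))
  | .prodOf _ f => .prod (Finset.univ.val.map f)

/-- Compilation of a Bayesian network to an arithmetic circuit: the variables are eliminated in
the reverse of the order of `V`, from the indicators and the conditional probability tables. The
factors left at the end have an empty scope; the root is their product. -/
noncomputable def compileAC {V : Type u} [Fintype V] [LinearOrder V] {Val : V → Type w}
    [∀ v, Fintype (Val v)] [∀ v, Nonempty (Val v)] (B : BayesNet V Val) :
    Circuit Val (ACNode Val B.dag) where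
  root :=
    let order := Finset.univ.sort (fun a b : V => a ≤ b)
    let initial := order.flatMap fun v => [Factor.ofIndicator B.dag v, Factor.ofCPT B.dag v]
    Factor.mulEntry (order.reverse.foldl Factor.eliminate initial)
      fun v => Classical.arbitrary (Val v)
  op := ACNode.op B

/-- The compilation algorithm, with the variables in `M` marginalized, returns `S`. -/
def BN2SPN {V : Type u} [Fintype V] [LinearOrder V] {Val : V → Type w} [∀ v, Fintype (Val v)]
    [∀ v, Nonempty (Val v)] (B : BayesNet V Val) (M : Set V)
    (S : Circuit Val (ACNode Val B.dag)) : Prop :=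
  ((compileAC B).redistribute.marginalize M).Simplifies S

/-! ## Decompilation -/

/-- The nodes of the augmented sum-product network. -/
inductive AugNode (N : Type*) where
  /-- a node of the given network -/
  | orig (n : N) : AugNode N
  /-- the product node that is put on the edge from the sum `s` to its child `c` -/
  | link (s c : N) : AugNode N
  /-- the indicator of the event that the latent variable of the sum `s` selects the child `c` -/
  | select (s c : N) : AugNode N
  /-- the twin of the sum `s` -/
  | twin (s : N) : AugNode N

namespace Circuit

variable {V : Type u} {Val : V → Type w} {N : Type*}

/-- The edges of the augmented network. The child `c` of a sum `s` is multiplied by the indicator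
that `s` selects `c` and by the twin of every sum below `s` that `c` does not reach; a twin has
the indicators of its sum as children. -/
inductive AugChild (C : Circuit Val N) : AugNode N → AugNode N → Prop
  | prod {n c : N} : C.IsProd n → C.IsChild n c → AugChild C (.orig n) (.orig c)
  | sum {s c : N} : C.IsSum s → C.IsChild s c → AugChild C (.orig s) (.link s c)
  | link {s c : N} : C.IsSum s → C.IsChild s c → AugChild C (.link s c) (.orig c)
  | select {s c : N} : C.IsSum s → C.IsChild s c → AugChild C (.link s c) (.select s c)
  | linkTwin {s c t : N} : C.IsSum s → C.IsChild s c → C.IsSum t → C.IsAncestor s t →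
      ¬ C.Reach c t → AugChild C (.link s c) (.twin t)
  | twin {s c : N} : C.IsSum s → C.IsChild s c → AugChild C (.twin s) (.select s c)

/-- Reachability in the augmented network. -/
def AugReach (C : Circuit Val N) : AugNode N → AugNode N → Prop :=
  Relation.ReflTransGen C.AugChild

/-- The ancestor sum `s` of the node `n` is conditioning: in the augmented network, it is not true
that all children of `s` reach the same subset of the set that consists of `n` and its twin. -/
def IsConditioning (C : Circuit Val N) (s n : N) : Prop :=
  C.IsSum s ∧ C.IsAncestor s n ∧
  ¬ ∀ d d', C.AugChild (.orig s) d → C.AugChild (.orig s) d' →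
    (C.AugReach d (.orig n) ↔ C.AugReach d' (.orig n)) ∧
    (C.AugReach d (.twin n) ↔ C.AugReach d' (.twin n))

/-- There is a directed path from the root to `n` with `k` sum nodes before `n`. -/
inductive PathSums (C : Circuit Val N) : ℕ → N → Prop
  | root : PathSums C 0 C.root
  | sum {k : ℕ} {n c : N} : PathSums C k n → C.IsSum n → C.IsChild n c → PathSums C (k + 1) c
  | prod {k : ℕ} {n c : N} : PathSums C k n → C.IsProd n → C.IsChild n c → PathSums C k c

/-- The largest number of sum nodes on a path from the root to `n`, `n` itself not counted. -/
noncomputable def sumDepth (C : Circuit Val N) (n : N) : ℕ := sSup {k | C.PathSums k n}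

/-- The variable `v` is in the scope of the node: the scope of a leaf consists of its variable,
and the scope of another node is the union of the scopes of its children. -/
inductive InScope (C : Circuit Val N) (v : V) : N → Prop
  | leaf {n : N} : C.IsLeafOf v n → InScope C v n
  | child {n c : N} : C.IsChild n c → InScope C v c → InScope C v n

/-- The sum-region of `s`: the sum nodes with the same sum-depth and the same scope as `s`. -/
def sumRegion (C : Circuit Val N) (s : N) : Set N :=
  {t | C.Live t ∧ C.IsSum t ∧ C.sumDepth t = C.sumDepth s ∧ ∀ v, C.InScope v t ↔ C.InScope v s}

/-- The latent variables suggested by the decompilation: one for each sum-region. -/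
def Latent (C : Circuit Val N) : Type _ :=
  {R : Set N // ∃ s, C.Live s ∧ C.IsSum s ∧ R = C.sumRegion s}

/-- The observed variables: those of the leaves of the network. -/
def Observed (C : Circuit Val N) : Type _ :=
  {v : V // ∃ n, C.Live n ∧ C.IsLeafOf v n}

/-- The node `n` of the network belongs to the given variable. -/
def Represents (C : Circuit Val N) (n : N) : C.Latent ⊕ C.Observed → Prop
  | .inl Z => n ∈ Z.1
  | .inr X => C.Live n ∧ C.IsLeafOf X.1 n

end Circuit

/-- The decompilation algorithm: a directed graph on the latent and the observed variables. For
every node `n` (a sum or a leaf) and every conditioning ancestor sum `s` of `n` there is an edge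
from the latent variable of `s` to the variable of `n`. -/
def SPN2BN {V : Type u} {Val : V → Type w} {N : Type*} (C : Circuit Val N) :
    Digraph (C.Latent ⊕ C.Observed) where
  Adj a b := ∃ Z : C.Latent, a = .inl Z ∧
    ∃ s n, s ∈ Z.1 ∧ C.Represents n b ∧ C.IsConditioning s n

end SPN

/-!
The moral closure is the graph of variable elimination. Let `v` be the *elimination parent* of `c`
if it is the largest parent of `c` in the moral closure (`ElimChild`). The table that results from
the elimination of `c` is indexed by the parents of `c` in the moral closure
(`mem_scope_message`), and it is consumed when the elimination parent of `c` is eliminated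
(`foldl_eliminate`). The inner vertices of the resulting elimination forest are the internal
variables (`exists_elimChild_iff`).

Hence the compiled network is the elimination forest unrolled (`IsUnrolled`): there is one sum node
`sumNode G v x` for every variable `v` and all values `x` of its parents in the moral closure, and
distinct values give distinct nodes since the parameters are symbolic (`sumNode_inj`). The summand
for the value `a` of `v` is the product of the sum nodes of the children of `v` in the forest, with
`v = a`, and of the indicator of `v = a` unless `v` is marginalized. Simplification only replaces
the sum nodes of the variables without children by terminal nodes and lumps products; after one
pass nothing is left to be done (`IsUnrolled.same_simplifyPass`).

The sum-depth of `sumNode G v x` is the depth of `v` in the forest, and its scope is the set of the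
variables that lie weakly below `v` and are not marginalized. Subtrees rooted at the same depth are
disjoint and contain leaves, which are never marginalized, so the sum-regions correspond to the
internal variables (`IsUnrolled.sumRegion_sumNode`).

It remains to find the conditioning sums. Let `u` be a proper ancestor of `v` in the forest. If `u`
is a parent of `v` in the moral closure, a node of `v` fixes the value of `u`, so that exactly one
summand of a sum node of `u` above it reaches it; as `u` has two values, the sum is conditioning.
Otherwise all the summands reach the node of `v`; and if below one summand a sum node of some `t`
between `u` and `v` has a link with the twin of the node, then so has the copy of that sum node
below every other summand (`IsUnrolled.isConditioning_sumNode_iff`). The indicators of an internal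
variable `v` that is not marginalized are reached from each summand of every sum node strictly above
those of `v`, but only from one summand of a sum node of `v`
(`IsUnrolled.isConditioning_indicator_iff`).
-/

namespace SPN

open Relation

/-! ### The moral closure and the elimination tree -/

section MoralClosure

variable {V : Type*} [LinearOrder V] {G : Digraph V}

theorem moralStep_iterate_mono {k l : ℕ} (hkl : k ≤ l) {a b : V}
    (h : (moralStep^[k] G).Adj a b) : (moralStep^[l] G).Adj a b := by
  induction l, hkl using Nat.le_induction with
  | base => exact h
  | succ n _ ih =>
    rw [Function.iterate_succ_apply']
    exact Or.inl ih

theorem moralClosure_of_adj {a b : V} (h : G.Adj a b) : (moralClosure G).Adj a b := ⟨0, h⟩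

/-- Moralization edges follow the order, so a topological order of the graph is one of its moral
closure. -/
theorem moralClosure_lt (htop : ∀ p v, G.Adj p v → p < v) {a b : V}
    (h : (moralClosure G).Adj a b) : a < b := by
  obtain ⟨k, h⟩ := h
  induction k generalizing a b with
  | zero => exact htop _ _ h
  | succ k ih =>
    rw [Function.iterate_succ_apply'] at h
    rcases h with h | h
    · exact ih h
    · exact h.1

theorem moralClosure_moral (htop : ∀ p v, G.Adj p v → p < v) {a b c : V}
    (hac : (moralClosure G).Adj a c) (hbc : (moralClosure G).Adj b c) (hab : a < b) :
    (moralClosure G).Adj a b := by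
  obtain ⟨k, hk⟩ := hac
  obtain ⟨l, hl⟩ := hbc
  by_cases h : (moralStep^[max k l] G).Adj a b
  · exact ⟨_, h⟩
  · refine ⟨max k l + 1, ?_⟩
    rw [Function.iterate_succ_apply']
    exact Or.inr ⟨hab, h, fun h' => lt_asymm hab (moralClosure_lt htop ⟨_, h'⟩), c,
      moralStep_iterate_mono (le_max_left _ _) hk, moralStep_iterate_mono (le_max_right _ _) hl⟩

theorem moralClosure_cases {a b : V} (h : (moralClosure G).Adj a b) :
    G.Adj a b ∨ a < b ∧ ∃ c, (moralClosure G).Adj a c ∧ (moralClosure G).Adj b c := by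
  obtain ⟨k, h⟩ := h
  induction k with
  | zero => exact Or.inl h
  | succ k ih =>
    rw [Function.iterate_succ_apply'] at h
    rcases h with h | ⟨hab, -, -, c, hac, hbc⟩
    · exact ih h
    · exact Or.inr ⟨hab, c, ⟨k, hac⟩, ⟨k, hbc⟩⟩

theorem exists_adj_of_moralClosure {a b : V} (h : (moralClosure G).Adj a b) :
    ∃ c, G.Adj a c := by
  obtain ⟨k, h⟩ := h
  induction k generalizing b with
  | zero => exact ⟨b, h⟩
  | succ k ih =>
    rw [Function.iterate_succ_apply'] at h
    rcases h with h | ⟨-, -, -, c, hac, -⟩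
    · exact ih h
    · exact ih hac

/-- The edges of the elimination forest: `v` is the largest parent of `c` in the moral closure.
The table that results from the elimination of `c` is consumed when `v` is eliminated. The first
condition follows from the second one if the order is topological. -/
def ElimChild (G : Digraph V) (v c : V) : Prop :=
  v < c ∧ (moralClosure G).Adj v c ∧ ∀ u, (moralClosure G).Adj u c → u ≤ v

theorem ElimChild.unique {v w c : V} (hv : ElimChild G v c) (hw : ElimChild G w c) : v = w :=
  le_antisymm (hw.2.2 _ hv.2.1) (hv.2.2 _ hw.2.1)

theorem lt_of_transGen_elimChild {u v : V} (h : TransGen (ElimChild G) u v) : u < v := by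
  induction h with
  | single h => exact h.1
  | tail _ h ih => exact ih.trans h.1

/-- The other parents of `c` are passed on to its largest parent `v`. -/
theorem ElimChild.adj (htop : ∀ p v, G.Adj p v → p < v) {u v c : V} (h : ElimChild G v c)
    (hu : (moralClosure G).Adj u c) : u = v ∨ (moralClosure G).Adj u v := by
  rcases (h.2.2 u hu).eq_or_lt with h' | h'
  · exact Or.inl h'
  · exact Or.inr (moralClosure_moral htop hu h.2.1 h')

variable [Fintype V]

theorem exists_elimChild (htop : ∀ p v, G.Adj p v → p < v) {u c : V}
    (h : (moralClosure G).Adj u c) : ∃ v, ElimChild G v c := by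
  classical
  have hne : (Finset.univ.filter fun q => (moralClosure G).Adj q c).Nonempty :=
    ⟨u, by simpa using h⟩
  have hm := Finset.max'_mem _ hne
  rw [Finset.mem_filter] at hm
  exact ⟨_, moralClosure_lt htop hm.2, hm.2, fun q hq => Finset.le_max' _ _ (by simpa using hq)⟩

/-- The parents of `v` in the moral closure: the parents of `v` in the graph and those that its
children in the elimination forest pass on. -/
theorem moralClosure_adj_iff (htop : ∀ p v, G.Adj p v → p < v) {u v : V} :
    (moralClosure G).Adj u v ↔
      G.Adj u v ∨ u ≠ v ∧ ∃ c, ElimChild G v c ∧ (moralClosure G).Adj u c := by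
  constructor
  · intro h
    rcases moralClosure_cases h with h | ⟨huv, c, huc, hvc⟩
    · exact Or.inl h
    · refine Or.inr ⟨huv.ne, ?_⟩
      -- climb the elimination forest from the common child `c` until the parent is `v`
      induction c using WellFoundedLT.induction with
      | ind c ih =>
        obtain ⟨e, he⟩ := exists_elimChild htop hvc
        rcases he.adj htop hvc with rfl | hve
        · exact ⟨c, he, huc⟩
        · rcases he.adj htop huc with rfl | hue
          · exact absurd (moralClosure_lt htop hve) (lt_asymm huv)
          · exact ih e he.1 hue hve
  · rintro (h | ⟨hne, c, hc, hu⟩)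
    · exact moralClosure_of_adj h
    · exact (hc.adj htop hu).resolve_left hne

/-- The parents in the moral closure are ancestors in the elimination forest. -/
theorem transGen_elimChild_of_adj (htop : ∀ p v, G.Adj p v → p < v) {u v : V}
    (h : (moralClosure G).Adj u v) : TransGen (ElimChild G) u v := by
  induction v using WellFoundedLT.induction with
  | ind v ih =>
    obtain ⟨e, he⟩ := exists_elimChild htop h
    rcases he.adj htop h with rfl | hue
    · exact .single he
    · exact (ih e he.1 hue).tail he

/-- The inner vertices of the elimination forest are the internal variables. -/
theorem exists_elimChild_iff (htop : ∀ p v, G.Adj p v → p < v) {v : V} :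
    (∃ c, ElimChild G v c) ↔ ∃ c, G.Adj v c := by
  constructor
  · rintro ⟨c, hc⟩
    exact exists_adj_of_moralClosure hc.2.1
  · rintro ⟨c, hc⟩
    obtain ⟨d, hd, -⟩ := TransGen.head'_iff.1
      (transGen_elimChild_of_adj htop (moralClosure_of_adj hc))
    exact ⟨d, hd⟩

open Classical in
/-- The depth of `v` in the elimination forest: the number of its proper ancestors. -/
noncomputable def elimDepth (G : Digraph V) (v : V) : ℕ :=
  (Finset.univ.filter fun u => TransGen (ElimChild G) u v).card

theorem elimDepth_of_elimChild {v c : V} (h : ElimChild G v c) :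
    elimDepth G c = elimDepth G v + 1 := by
  classical
  have hv : v ∉ Finset.univ.filter fun u => TransGen (ElimChild G) u v := by
    intro h'
    exact lt_irrefl _ (lt_of_transGen_elimChild (Finset.mem_filter.1 h').2)
  unfold elimDepth
  rw [← Finset.card_insert_of_notMem hv]
  congr 1
  ext u
  simp only [Finset.mem_filter, Finset.mem_univ, true_and, Finset.mem_insert]
  constructor
  · intro hu
    obtain ⟨p, hp, hpc⟩ := TransGen.tail'_iff.1 hu
    rw [hpc.unique h] at hp
    exact (reflTransGen_iff_eq_or_transGen.1 hp).imp Eq.symm id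
  · rintro (rfl | hu)
    · exact .single h
    · exact hu.tail h

theorem elimDepth_eq_zero {v : V} (h : ∀ u, ¬ (moralClosure G).Adj u v) : elimDepth G v = 0 := by
  classical
  unfold elimDepth
  rw [Finset.card_eq_zero, Finset.filter_eq_empty_iff]
  intro u _ hu
  obtain ⟨p, -, hp⟩ := TransGen.tail'_iff.1 hu
  exact h _ hp.2.1

theorem elimDepth_lt {u v : V} (h : TransGen (ElimChild G) u v) :
    elimDepth G u < elimDepth G v := by
  induction h with
  | single h => rw [elimDepth_of_elimChild h]; exact Nat.lt_succ_self _
  | tail _ h ih => rw [elimDepth_of_elimChild h]; exact ih.trans (Nat.lt_succ_self _)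

/-- Subtrees of the elimination forest that are rooted at the same depth are disjoint. -/
theorem eq_of_elimDepth_eq {u v w : V} (hu : ReflTransGen (ElimChild G) u w)
    (hv : ReflTransGen (ElimChild G) v w) (h : elimDepth G u = elimDepth G v) : u = v := by
  have key : ReflTransGen (ElimChild G) u v ∨ ReflTransGen (ElimChild G) v u := by
    induction hu with
    | refl => exact Or.inr hv
    | tail hub hbc ih =>
      rcases ReflTransGen.cases_tail hv with h' | ⟨d, hvd, hdc⟩
      · subst h'
        exact Or.inl (hub.tail hbc)
      · rw [hdc.unique hbc] at hvd
        exact ih hvd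
  rcases key with h' | h'
  · rcases reflTransGen_iff_eq_or_transGen.1 h' with h' | h'
    · exact h'.symm
    · exact absurd h (elimDepth_lt h').ne
  · rcases reflTransGen_iff_eq_or_transGen.1 h' with h' | h'
    · exact h'
    · exact absurd h (elimDepth_lt h').ne'

/-- Every subtree of the elimination forest has a leaf. -/
theorem exists_leaf_of_elimForest (htop : ∀ p v, G.Adj p v → p < v) (v : V) :
    ∃ w, ReflTransGen (ElimChild G) v w ∧ ¬ ∃ c, G.Adj w c := by
  induction v using WellFoundedGT.induction with
  | ind v ih =>
    by_cases h : ∃ c, G.Adj v c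
    · obtain ⟨c, hc⟩ := (exists_elimChild_iff htop).2 h
      obtain ⟨w, hw, hw'⟩ := ih c hc.1
      exact ⟨w, .head hc hw, hw'⟩
    · exact ⟨v, .refl, h⟩

end MoralClosure

/-! ### Variable elimination in closed form -/

section Factors

variable {V : Type*} {Val : V → Type*} {G : Digraph V}

theorem entry_eq_of_mulEntry_eq {fs : List (Factor Val G)} {x y : ∀ v, Val v}
    (h : Factor.mulEntry fs x = Factor.mulEntry fs y) {φ : Factor Val G} (hφ : φ ∈ fs) :
    φ.entry x = φ.entry y := by
  obtain ⟨i, rfl⟩ := List.get_of_mem hφ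
  have h2 := (ACNode.prodOf.inj h).2
  exact congrFun (eq_of_heq h2) i

theorem mem_scope_ofIndicator {u v : V} : u ∈ (Factor.ofIndicator (Val := Val) G v).scope ↔ u = v :=
  Finset.mem_singleton

variable [Fintype V]

theorem mem_scope_ofCPT {u v : V} :
    u ∈ (Factor.ofCPT (Val := Val) G v).scope ↔ u = v ∨ G.Adj u v := by
  classical
  exact Finset.mem_filter.trans (and_iff_right (Finset.mem_univ _))

theorem mem_scope_sumOut {u v : V} {fs : List (Factor Val G)} :
    u ∈ (Factor.sumOut v fs).scope ↔ u ≠ v ∧ ∃ φ ∈ fs, u ∈ φ.scope := by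
  classical
  exact Finset.mem_filter.trans (and_iff_right (Finset.mem_univ _))

theorem eliminate_eq (fs : List (Factor Val G)) (v : V)
    [DecidablePred fun φ : Factor Val G => v ∈ φ.scope] :
    Factor.eliminate fs v =
      Factor.sumOut v (fs.filter fun φ => v ∈ φ.scope) :: fs.filter fun φ => v ∉ φ.scope := by
  unfold Factor.eliminate
  congr!

theorem sumOut_entry [DecidableEq V] (v : V) (fs : List (Factor Val G)) (x : ∀ v, Val v) :
    (Factor.sumOut v fs).entry x =
      .sumOver v fun a => Factor.mulEntry fs (Function.update x v a) := by
  unfold Factor.sumOut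
  congr!

end Factors

section Elimination

variable {V : Type*} [Fintype V] [LinearOrder V] {Val : V → Type*} {G : Digraph V}

open Classical in
/-- The children of `v` in the elimination forest, in increasing order. -/
noncomputable def elimChildren (G : Digraph V) (v : V) : List V :=
  (Finset.univ.sort fun a b : V => a ≤ b).filter fun c => ElimChild G v c

theorem mem_elimChildren {v c : V} : c ∈ elimChildren G v ↔ ElimChild G v c := by
  simp [elimChildren]

/-- The factor that the elimination of `v` creates: the tables received from the children of `v`
in the elimination forest are multiplied with the two initial factors of `v`, and `v` is summed
out. -/
noncomputable def message (Val : V → Type*) (G : Digraph V) (v : V) : Factor Val G :=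
  Factor.sumOut v (((elimChildren G v).attach.map fun c => message Val G c.1) ++
    [Factor.ofIndicator G v, Factor.ofCPT G v])
termination_by (Finset.univ.filter fun c => v < c).card
decreasing_by
  have hc := (mem_elimChildren.1 c.2).1
  refine Finset.card_lt_card (Finset.ssubset_iff_of_subset ?_ |>.2 ⟨c.1, ?_, ?_⟩)
  · intro d hd
    simp only [Finset.mem_filter, Finset.mem_univ, true_and] at hd ⊢
    exact hc.trans hd
  · simpa using hc
  · simp

/-- The factors that mention `v` when `v` is eliminated. -/
noncomputable def bucket (Val : V → Type*) (G : Digraph V) (v : V) : List (Factor Val G) :=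
  (elimChildren G v).map (message Val G) ++ [Factor.ofIndicator G v, Factor.ofCPT G v]

theorem message_eq (v : V) : message Val G v = Factor.sumOut v (bucket Val G v) := by
  rw [message, bucket]
  simp

/-- The table created by the elimination of `v` is indexed by the parents of `v` in the moral
closure. -/
theorem mem_scope_message (htop : ∀ p v, G.Adj p v → p < v) {u v : V} :
    u ∈ (message Val G v).scope ↔ (moralClosure G).Adj u v := by
  induction v using WellFoundedGT.induction with
  | ind v ih =>
    rw [moralClosure_adj_iff htop, message_eq]
    simp only [mem_scope_sumOut, bucket, List.mem_append, List.mem_map, mem_elimChildren,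
      List.mem_cons, List.not_mem_nil, or_false]
    constructor
    · rintro ⟨hne, φ, ⟨c, hc, rfl⟩ | rfl | rfl, hu⟩
      · exact Or.inr ⟨hne, c, hc, (ih c hc.1).1 hu⟩
      · exact absurd (mem_scope_ofIndicator.1 hu) hne
      · exact Or.inl ((mem_scope_ofCPT.1 hu).resolve_left hne)
    · rintro (hu | ⟨hne, c, hc, hu⟩)
      · exact ⟨(htop _ _ hu).ne, _, Or.inr (Or.inr rfl), mem_scope_ofCPT.2 (Or.inr hu)⟩
      · exact ⟨hne, _, Or.inl ⟨c, hc, rfl⟩, (ih c hc.1).2 hu⟩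

/-- The initial factors of a variable. -/
noncomputable def initialFactors (Val : V → Type*) (G : Digraph V) (v : V) :
    List (Factor Val G) :=
  [Factor.ofIndicator G v, Factor.ofCPT G v]

open Classical in
/-- The state of variable elimination when the variables in `l₂` are eliminated and those in `l₁`
are not: the messages that are not consumed and the initial factors of the variables in `l₁`. -/
theorem foldl_eliminate (htop : ∀ p v, G.Adj p v → p < v) (l₁ l₂ : List V)
    (hl : l₁ ++ l₂ = Finset.univ.sort fun a b : V => a ≤ b) :
    l₂.reverse.foldl Factor.eliminate ((l₁ ++ l₂).flatMap (initialFactors Val G)) =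
      (l₂.filter fun c => ∀ q, (moralClosure G).Adj q c → q ∈ l₁).map (message Val G) ++
        l₁.flatMap (initialFactors Val G) := by
  induction l₂ generalizing l₁ with
  | nil => simp
  | cons v l₂ ih =>
    have hl' : (l₁ ++ [v]) ++ l₂ = Finset.univ.sort fun a b : V => a ≤ b := by simpa using hl
    have hsort : (l₁ ++ v :: l₂).Pairwise (· < ·) := by
      rw [hl]
      exact (Finset.sortedLT_sort _).pairwise
    rw [List.pairwise_append] at hsort
    obtain ⟨-, h₂, h₁₂⟩ := hsort
    have hl₁ : ∀ u ∈ l₁, u < v := fun u hu => h₁₂ u hu v (by simp)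
    have hl₂ : ∀ u ∈ l₂, v < u := (List.pairwise_cons.1 h₂).1
    have hmem : ∀ u, u ∈ l₁ ∨ u = v ∨ u ∈ l₂ := by
      intro u
      have : u ∈ l₁ ++ v :: l₂ := by rw [hl]; simp
      simpa using this
    have hmem₁ : ∀ u, u ∈ l₁ ↔ u < v := by
      intro u
      refine ⟨hl₁ u, fun hu => ?_⟩
      rcases hmem u with h | rfl | h
      · exact h
      · exact absurd hu (lt_irrefl _)
      · exact absurd hu (lt_asymm (hl₂ u h))
    have hinit : l₁ ++ v :: l₂ = (l₁ ++ [v]) ++ l₂ := by simp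
    rw [List.reverse_cons, List.foldl_append, hinit, ih (l₁ ++ [v]) hl']
    simp only [List.foldl_cons, List.foldl_nil, eliminate_eq, List.filter_append,
      List.flatMap_append, List.flatMap_cons, List.flatMap_nil, List.append_nil, List.filter_map,
      List.filter_filter]
    -- the initial factors of the other variables do not mention `v`
    have hno : ∀ φ ∈ l₁.flatMap (initialFactors Val G), v ∉ φ.scope := by
      intro φ hφ
      obtain ⟨u, hu, hφ⟩ := List.mem_flatMap.1 hφ
      have huv := hl₁ u hu
      simp only [initialFactors, List.mem_cons, List.not_mem_nil, or_false] at hφ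
      rcases hφ with rfl | rfl
      · exact fun h => huv.ne' (mem_scope_ofIndicator.1 h)
      · exact fun h => (mem_scope_ofCPT.1 h).elim huv.ne' fun h => lt_asymm huv (htop _ _ h)
    have e1 : (l₁.flatMap (initialFactors Val G)).filter (fun φ => decide (v ∈ φ.scope)) = [] := by
      rw [List.filter_eq_nil_iff]
      intro φ hφ
      simpa using hno φ hφ
    have e2 : (l₁.flatMap (initialFactors Val G)).filter (fun φ => decide (v ∉ φ.scope)) =
        l₁.flatMap (initialFactors Val G) := by
      rw [List.filter_eq_self]
      intro φ hφ
      simpa using hno φ hφ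
    have e3 : (initialFactors Val G v).filter (fun φ => decide (v ∈ φ.scope)) =
        initialFactors Val G v := by
      simp [initialFactors, mem_scope_ofIndicator, mem_scope_ofCPT]
    have e4 : (initialFactors Val G v).filter (fun φ => decide (v ∉ φ.scope)) = [] := by
      simp [initialFactors, mem_scope_ofIndicator, mem_scope_ofCPT]
    have e5 : l₂.filter (fun c => ((fun φ : Factor Val G => decide (v ∈ φ.scope)) ∘
          message Val G) c && decide (∀ q, (moralClosure G).Adj q c → q ∈ l₁ ++ [v])) =
        elimChildren G v := by
      have h1 : (l₁ ++ [v]).filter (fun c => decide (ElimChild G v c)) = [] := by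
        rw [List.filter_eq_nil_iff]
        intro c hc h
        have hlt : v < c := (of_decide_eq_true h).1
        simp only [List.mem_append, List.mem_singleton] at hc
        rcases hc with hc | rfl
        · exact lt_asymm hlt (hl₁ c hc)
        · exact lt_irrefl _ hlt
      rw [elimChildren, ← hl', List.filter_append, h1, List.nil_append]
      refine List.filter_congr fun c hc => ?_
      rw [Bool.eq_iff_iff]
      simp only [Function.comp, Bool.and_eq_true, decide_eq_true_eq, mem_scope_message htop,
        List.mem_append, List.mem_singleton, hmem₁, ← le_iff_lt_or_eq]
      exact ⟨fun h => ⟨hl₂ c hc, h.1, h.2⟩, fun h => ⟨h.2.1, h.2.2⟩⟩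
    have e6 : l₂.filter (fun c => ((fun φ : Factor Val G => decide (v ∉ φ.scope)) ∘
          message Val G) c && decide (∀ q, (moralClosure G).Adj q c → q ∈ l₁ ++ [v])) =
        l₂.filter fun c => decide (∀ q, (moralClosure G).Adj q c → q ∈ l₁) := by
      refine List.filter_congr fun c hc => ?_
      rw [Bool.eq_iff_iff]
      simp only [Function.comp, Bool.and_eq_true, decide_eq_true_eq, mem_scope_message htop,
        List.mem_append, List.mem_singleton]
      constructor
      · rintro ⟨h1, h2⟩ q hq
        exact (h2 q hq).resolve_right fun h => h1 (h ▸ hq)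
      · intro h
        exact ⟨fun hv => lt_irrefl _ (hl₁ v (h v hv)), fun q hq => Or.inl (h q hq)⟩
    have e7 : (v :: l₂).filter (fun c => decide (∀ q, (moralClosure G).Adj q c → q ∈ l₁)) =
        v :: l₂.filter fun c => decide (∀ q, (moralClosure G).Adj q c → q ∈ l₁) := by
      refine List.filter_cons_of_pos ?_
      simp only [decide_eq_true_eq]
      exact fun q hq => (hmem₁ q).2 (moralClosure_lt htop hq)
    rw [e1, e2, e3, e4, e5, e6, e7, List.nil_append, List.append_nil, List.map_cons, message_eq]
    rfl

open Classical in
/-- The roots of the elimination forest, in increasing order. -/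
noncomputable def elimRoots (G : Digraph V) : List V :=
  (Finset.univ.sort fun a b : V => a ≤ b).filter fun c => ∀ q, ¬ (moralClosure G).Adj q c

theorem mem_elimRoots {v : V} : v ∈ elimRoots G ↔ ∀ q, ¬ (moralClosure G).Adj q v := by
  simp [elimRoots]

/-- The node of the arithmetic circuit that sums over the values of `v`, given the values `x` of
the parents of `v` in the moral closure. -/
noncomputable def sumNode (G : Digraph V) (v : V) (x : ∀ v, Val v) : ACNode Val G :=
  (message Val G v).entry x

/-- The summand of `sumNode G v x` for the value `a` of `v`. -/
noncomputable def prodNode (G : Digraph V) (v : V) (x : ∀ v, Val v) (a : Val v) : ACNode Val G :=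
  Factor.mulEntry (bucket Val G v) (Function.update x v a)

theorem sumNode_eq (v : V) (x : ∀ v, Val v) :
    sumNode G v x = .sumOver v (prodNode G v x) := by
  rw [sumNode, message_eq, sumOut_entry]
  rfl

theorem sumNode_congr (htop : ∀ p v, G.Adj p v → p < v) {v : V} {x y : ∀ v, Val v}
    (h : ∀ q, (moralClosure G).Adj q v → x q = y q) : sumNode G v x = sumNode G v y :=
  Factor.entry_congr _ _ _ fun q hq => h q ((mem_scope_message htop).1 hq)

theorem sumNode_ne_indicator {u v : V} {x : ∀ v, Val v} {b : Val v} :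
    sumNode G u x ≠ .indicator v b := by
  rw [sumNode_eq]
  intro h
  cases h

theorem eq_of_sumNode_eq {v w : V} {x y : ∀ v, Val v} (h : sumNode G v x = sumNode G w y) :
    v = w := by
  rw [sumNode_eq, sumNode_eq] at h
  exact (ACNode.sumOver.inj h).1

/-- Different entries of a table are different nodes, because the parameters are symbolic. -/
theorem sumNode_inj (htop : ∀ p v, G.Adj p v → p < v) [∀ v, Nonempty (Val v)] {v : V}
    {x y : ∀ v, Val v} (h : sumNode G v x = sumNode G v y) {q : V}
    (hq : (moralClosure G).Adj q v) : x q = y q := by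
  induction v using WellFoundedGT.induction generalizing x y with
  | ind v ih =>
    have hne : q ≠ v := (moralClosure_lt htop hq).ne
    let a : Val v := Classical.arbitrary _
    have h' : prodNode G v x a = prodNode G v y a := by
      rw [sumNode_eq, sumNode_eq] at h
      exact congrFun (eq_of_heq (ACNode.sumOver.inj h).2) a
    rcases (moralClosure_adj_iff htop).1 hq with hq' | ⟨-, c, hc, hqc⟩
    · have h1 := entry_eq_of_mulEntry_eq h' (φ := Factor.ofCPT G v) (by simp [bucket])
      have h2 := (ACNode.param.inj h1).2.2
      have h3 := congrFun (eq_of_heq h2) ⟨q, hq'⟩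
      simpa [Function.update_of_ne hne] using h3
    · have h1 := entry_eq_of_mulEntry_eq h' (φ := message Val G c)
        (List.mem_append_left _ (List.mem_map.2 ⟨c, mem_elimChildren.2 hc, rfl⟩))
      simpa [Function.update_of_ne hne] using ih c hc.1 h1 hqc

theorem compileAC_root [∀ v, Fintype (Val v)] [∀ v, Nonempty (Val v)] (B : BayesNet V Val)
    (htop : B.IsTopological) :
    (compileAC B).root = Factor.mulEntry ((elimRoots B.dag).map (message Val B.dag))
      fun v => Classical.arbitrary (Val v) := by
  have h := foldl_eliminate (Val := Val) htop [] (Finset.univ.sort fun a b : V => a ≤ b) rfl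
  simp only [List.nil_append, List.not_mem_nil, imp_false, List.flatMap_nil,
    List.append_nil] at h
  change Factor.mulEntry (List.foldl Factor.eliminate _ _) _ = _
  congr 1
  refine h.trans ?_
  rw [elimRoots]
  congr!
  exact iff_of_false List.not_mem_nil id

end Elimination

/-! ### The shape of the compiled network -/

section Passes

variable {V : Type*} {Val : V → Type*} {N : Type*} {C : Circuit Val N}

theorem Circuit.isChild_of_sum {n c : N} {ch : Multiset (ℝ × N)} (h : C.op n = .sum ch) :
    C.IsChild n c ↔ ∃ r, (r, c) ∈ ch := by
  simp [IsChild, h]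

theorem Circuit.isChild_of_prod {n c : N} {ch : Multiset N} (h : C.op n = .prod ch) :
    C.IsChild n c ↔ c ∈ ch := by
  simp [IsChild, h]

theorem Circuit.addTerminals_op_of_notMem {n : N} {ch : Multiset (ℝ × N)} (h : C.op n = .sum ch)
    {e : ℝ × N} (he : e ∈ ch) (hop : ∀ v x, C.op e.2 ≠ .indicator v x) :
    C.addTerminals.op n = .sum ch := by
  simp only [addTerminals, h]
  rw [dif_neg]
  rintro ⟨-, v, hv⟩
  obtain ⟨x, hx⟩ := hv e he
  exact hop v x hx

theorem Circuit.addTerminals_op_of_indicators {n : N} {ch : Multiset (ℝ × N)}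
    (h : C.op n = .sum ch) (hne : ch ≠ 0) {v : V}
    (hop : ∀ e ∈ ch, ∃ x, C.op e.2 = .indicator v x) :
    ∃ p, C.addTerminals.op n = .terminal v p := by
  have hcond : ch ≠ 0 ∧ ∃ v, ∀ e ∈ ch, ∃ x, C.op e.2 = .indicator v x := ⟨hne, v, hop⟩
  have hv : hcond.2.choose = v := by
    obtain ⟨e, he⟩ := Multiset.exists_mem_of_ne_zero hne
    obtain ⟨x, hx⟩ := hop e he
    obtain ⟨y, hy⟩ := hcond.2.choose_spec e he
    rw [hx] at hy
    exact (Op.indicator.inj hy).1.symm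
  simp only [addTerminals, h]
  rw [dif_pos hcond]
  generalize_proofs
  revert hv
  generalize Exists.choose _ = u
  rintro rfl
  exact ⟨_, rfl⟩

theorem Circuit.removeProductsOfProducts_op_of_prod {n : N} {ch : Multiset N}
    (h : C.op n = .prod ch) (hch : ∀ m ∈ ch, ¬ C.IsProd m) :
    C.removeProductsOfProducts.op n = .prod ch := by
  simp only [removeProductsOfProducts, h]
  split_ifs with h'
  · -- only an empty product satisfies the condition
    have : ch = 0 := Multiset.eq_zero_of_forall_notMem fun m hm => hch m hm (h' m hm)
    simp [this]
  · rfl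

theorem Circuit.rep_of_not_isProd {n : N} (h : ¬ C.IsProd n) : C.rep n = n := by
  rw [rep, if_neg fun h' => h h'.2]

theorem Circuit.rep_spec {n : N} (hl : C.Live n) (h : C.IsProd n) :
    C.Live (C.rep n) ∧ C.op (C.rep n) = C.op n := by
  rw [rep, if_pos ⟨hl, h⟩]
  exact @Classical.epsilon_spec_aux N ⟨n⟩ (fun m => C.Live m ∧ C.op m = C.op n) ⟨n, hl, rfl⟩

theorem Circuit.rep_eq_of_op_eq {m n : N} (hm : C.Live m) (hn : C.Live n) (h : C.IsProd m)
    (hop : C.op m = C.op n) : C.rep m = C.rep n := by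
  have h' : C.IsProd n := by rwa [IsProd, ← hop]
  rw [rep, if_pos ⟨hm, h⟩, rep, if_pos ⟨hn, h'⟩, hop]

theorem Circuit.marginalize_op_of_prod {M : Set V} {n : N} {ch ch' : Multiset N}
    (h : C.op n = .prod (ch + ch')) (hch : ∀ m ∈ ch, ∀ v ∈ M, ∀ x, C.op m ≠ .indicator v x)
    (hch' : ∀ m ∈ ch', ∃ v ∈ M, ∃ x, C.op m = .indicator v x) :
    (C.marginalize M).op n = .prod ch := by
  classical
  simp only [marginalize, h]
  rw [Multiset.filter_add, Multiset.filter_eq_self.2, Multiset.filter_eq_nil.2, add_zero]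
  · exact fun m hm => not_not.2 (hch' m hm)
  · rintro m hm ⟨v, hv, x, hx⟩
    exact hch m hm v hv x hx

/-- No two product nodes of the circuit have the same children. -/
def Circuit.IsLumped (C : Circuit Val N) : Prop :=
  ∀ m n, C.Live m → C.Live n → C.IsProd m → C.op m = C.op n → m = n

theorem Circuit.IsLumped.rep_eq (h : C.IsLumped) (n : N) : C.rep n = n := by
  by_cases hn : C.Live n ∧ C.IsProd n
  · obtain ⟨h1, h2⟩ := C.rep_spec hn.1 hn.2
    exact (h n _ hn.1 h1 hn.2 h2.symm).symm
  · rw [rep, if_neg hn]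

theorem Circuit.IsLumped.lumpProducts_eq (h : C.IsLumped) : C.lumpProducts = C := by
  have hrep : C.rep = id := funext h.rep_eq
  have hop : C.lumpProducts.op = C.op := by
    funext n
    simp only [lumpProducts, hrep]
    cases hn : C.op n <;> simp
  have hroot : C.lumpProducts.root = C.root := h.rep_eq _
  cases C
  simp only [lumpProducts, Circuit.mk.injEq] at hop hroot ⊢
  exact ⟨hroot, hop⟩

end Passes

section Summands

variable {V : Type*} [Fintype V] [LinearOrder V] {Val : V → Type*}

open Classical in
/-- The factors of the summand of `sumNode G v x` for the value `a` of `v`, after the parameters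
and the indicators of the variables in `M` have been dropped. -/
noncomputable def summandFactors (G : Digraph V) (M : Set V) (v : V) (x : ∀ v, Val v)
    (a : Val v) : Multiset (ACNode Val G) :=
  (((elimChildren G v).map fun c => sumNode G c (Function.update x v a) : List (ACNode Val G)) :
    Multiset (ACNode Val G)) + if v ∈ M then 0 else {.indicator v a}

theorem mem_summandFactors {G : Digraph V} {M : Set V} {v : V} {x : ∀ v, Val v} {a : Val v}
    {n : ACNode Val G} :
    n ∈ summandFactors G M v x a ↔
      (∃ c, ElimChild G v c ∧ n = sumNode G c (Function.update x v a)) ∨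
        v ∉ M ∧ n = .indicator v a := by
  unfold summandFactors
  split_ifs with h <;> simp [mem_elimChildren, h, eq_comm]

theorem internal_of_elimChild [∀ v, Fintype (Val v)] {B : BayesNet V Val}
    (htop : B.IsTopological) {v c : V} (h : ElimChild B.dag v c) :
    B.Internal v :=
  (exists_elimChild_iff htop).1 ⟨c, h⟩

end Summands

section Unrolled

variable {V : Type*} [Fintype V] [LinearOrder V] {Val : V → Type*} [∀ v, Fintype (Val v)]
  [∀ v, Nonempty (Val v)]

/-- The circuit is the one that variable elimination unrolls along the elimination forest: one sum
node for every variable `v` and all values of its parents in the moral closure, whose summands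
`R v x a` are products over the children of `v` in the forest. The weights are `w`; the nodes of
the variables without children have the labels `L`. The representatives `R` of the summands are
left open since lumping changes them. -/
structure IsUnrolled (B : BayesNet V Val) (M : Set V)
    (R : ∀ v, (∀ v, Val v) → Val v → ACNode Val B.dag) (w : ∀ v, (∀ v, Val v) → Val v → ℝ)
    (L : V → (∀ v, Val v) → Op Val (ACNode Val B.dag))
    (C : Circuit Val (ACNode Val B.dag)) : Prop where
  root_op : C.op C.root = .prod ((elimRoots B.dag).map fun r =>
    sumNode B.dag r fun v => Classical.arbitrary (Val v) : List (ACNode Val B.dag))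
  sum_op : ∀ v x, B.Internal v →
    C.op (sumNode B.dag v x) = .sum (Finset.univ.val.map fun a => (w v x a, R v x a))
  prod_op : ∀ v x a, B.Internal v → C.op (R v x a) = .prod (summandFactors B.dag M v x a)
  indicator_op : ∀ v a, v ∉ M → C.op (.indicator v a) = .indicator v a
  leaf_op : ∀ v x, ¬ B.Internal v → C.op (sumNode B.dag v x) = L v x

/-- The labels in `L` of the variables without children are univariate distributions. -/
def AllTerminal (B : BayesNet V Val) (L : V → (∀ v, Val v) → Op Val (ACNode Val B.dag)) : Prop :=
  ∀ v x, ¬ B.Internal v → ∃ p, L v x = .terminal v p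

namespace IsUnrolled

variable {B : BayesNet V Val} {M : Set V} {R R' : ∀ v, (∀ v, Val v) → Val v → ACNode Val B.dag}
  {w : ∀ v, (∀ v, Val v) → Val v → ℝ} {L : V → (∀ v, Val v) → Op Val (ACNode Val B.dag)}
  {C D : Circuit Val (ACNode Val B.dag)}

theorem isChild_root (h : IsUnrolled B M R w L C) {c : ACNode Val B.dag} :
    C.IsChild C.root c ↔ ∃ r, (∀ q, ¬ (moralClosure B.dag).Adj q r) ∧
      c = sumNode B.dag r fun v => Classical.arbitrary (Val v) := by
  rw [Circuit.isChild_of_prod h.root_op]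
  simp [mem_elimRoots, eq_comm]

theorem isChild_sumNode (h : IsUnrolled B M R w L C) {v : V} (hv : B.Internal v)
    {x : ∀ v, Val v} {c : ACNode Val B.dag} :
    C.IsChild (sumNode B.dag v x) c ↔ ∃ a, c = R v x a := by
  rw [Circuit.isChild_of_sum (h.sum_op v x hv)]
  simp [eq_comm]

theorem isChild_summand (h : IsUnrolled B M R w L C) {v : V} (hv : B.Internal v)
    {x : ∀ v, Val v} {a : Val v} {c : ACNode Val B.dag} :
    C.IsChild (R v x a) c ↔
      (∃ d, ElimChild B.dag v d ∧ c = sumNode B.dag d (Function.update x v a)) ∨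
        v ∉ M ∧ c = .indicator v a := by
  rw [Circuit.isChild_of_prod (h.prod_op v x a hv), mem_summandFactors]

theorem not_isChild_leaf (h : IsUnrolled B M R w L C) (hL : AllTerminal B L) {v : V}
    (hv : ¬ B.Internal v) {x : ∀ v, Val v} {c : ACNode Val B.dag} :
    ¬ C.IsChild (sumNode B.dag v x) c := by
  obtain ⟨p, hp⟩ := hL v x hv
  simp [Circuit.IsChild, h.leaf_op v x hv, hp]

theorem not_isChild_indicator (h : IsUnrolled B M R w L C) {v : V} (hv : v ∉ M) {a : Val v}
    {c : ACNode Val B.dag} : ¬ C.IsChild (.indicator v a) c := by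
  simp [Circuit.IsChild, h.indicator_op v a hv]

theorem not_isProd_indicator (h : IsUnrolled B M R w L C) {v : V} (hv : v ∉ M) {a : Val v} :
    ¬ C.IsProd (.indicator v a) := by
  simp [Circuit.IsProd, h.indicator_op v a hv]

theorem not_isProd_sumNode (h : IsUnrolled B M R w L C) (hL : AllTerminal B L) (v : V)
    (x : ∀ v, Val v) : ¬ C.IsProd (sumNode B.dag v x) := by
  by_cases hv : B.Internal v
  · simp [Circuit.IsProd, h.sum_op v x hv]
  · obtain ⟨p, hp⟩ := hL v x hv
    simp [Circuit.IsProd, h.leaf_op v x hv, hp]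

/-- Every table entry is used. -/
theorem live_sumNode (htop : B.IsTopological) (h : IsUnrolled B M R w L C) (v : V)
    (x : ∀ v, Val v) : C.Live (sumNode B.dag v x) := by
  induction v using WellFoundedLT.induction with
  | ind v ih =>
    by_cases hv : ∃ u, (moralClosure B.dag).Adj u v
    · obtain ⟨u, hu⟩ := hv
      obtain ⟨p, hp⟩ := exists_elimChild htop hu
      have hpi := internal_of_elimChild htop hp
      refine ((ih p hp.1).tail ((h.isChild_sumNode hpi).2 ⟨x p, rfl⟩)).tail
        ((h.isChild_summand hpi).2 (Or.inl ⟨v, hp, ?_⟩))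
      rw [Function.update_eq_self]
    · push Not at hv
      rw [sumNode_congr (y := fun v => Classical.arbitrary (Val v)) htop
        fun q hq => absurd hq (hv q)]
      exact .single (h.isChild_root.2 ⟨v, hv, rfl⟩)

theorem live_summand (htop : B.IsTopological) (h : IsUnrolled B M R w L C) {v : V}
    (hv : B.Internal v) (x : ∀ v, Val v) (a : Val v) : C.Live (R v x a) :=
  (h.live_sumNode htop v x).tail ((h.isChild_sumNode hv).2 ⟨a, rfl⟩)

theorem live_indicator (htop : B.IsTopological) (h : IsUnrolled B M R w L C) {v : V}
    (hv : B.Internal v) (hM : v ∉ M) (a : Val v) : C.Live (.indicator v a) :=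
  (h.live_summand htop hv (fun v => Classical.arbitrary (Val v)) a).tail
    ((h.isChild_summand hv).2 (Or.inr ⟨hM, rfl⟩))

theorem live_cases (h : IsUnrolled B M R w L C) (hL : AllTerminal B L)
    {n : ACNode Val B.dag} (hn : C.Live n) :
    n = C.root ∨ (∃ v x, n = sumNode B.dag v x) ∨ (∃ v x a, B.Internal v ∧ n = R v x a) ∨
      ∃ v a, B.Internal v ∧ v ∉ M ∧ n = .indicator v a := by
  induction hn with
  | refl => exact Or.inl rfl
  | tail _ hc ih =>
    rcases ih with rfl | ⟨v, x, rfl⟩ | ⟨v, x, a, hv, rfl⟩ | ⟨v, a, hv, hM, rfl⟩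
    · obtain ⟨r, -, rfl⟩ := h.isChild_root.1 hc
      exact Or.inr (Or.inl ⟨_, _, rfl⟩)
    · by_cases hv : B.Internal v
      · obtain ⟨a, rfl⟩ := (h.isChild_sumNode hv).1 hc
        exact Or.inr (Or.inr (Or.inl ⟨_, _, _, hv, rfl⟩))
      · exact absurd hc (h.not_isChild_leaf hL hv)
    · rcases (h.isChild_summand hv).1 hc with ⟨d, -, rfl⟩ | ⟨hM, rfl⟩
      · exact Or.inr (Or.inl ⟨_, _, rfl⟩)
      · exact Or.inr (Or.inr (Or.inr ⟨_, _, hv, hM, rfl⟩))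
    · exact absurd hc (h.not_isChild_indicator hM)

theorem live_and_op_eq (htop : B.IsTopological) (h : IsUnrolled B M R w L C)
    (hL : AllTerminal B L) (h' : IsUnrolled B M R w L D) (hroot : C.root = D.root)
    {n : ACNode Val B.dag} (hn : C.Live n) : D.Live n ∧ C.op n = D.op n := by
  rcases h.live_cases hL hn with rfl | ⟨v, x, rfl⟩ | ⟨v, x, a, hv, rfl⟩ | ⟨v, a, hv, hM, rfl⟩
  · refine ⟨by rw [hroot]; exact .refl, ?_⟩
    rw [h.root_op, hroot, h'.root_op]
  · refine ⟨h'.live_sumNode htop v x, ?_⟩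
    by_cases hv : B.Internal v
    · rw [h.sum_op v x hv, h'.sum_op v x hv]
    · rw [h.leaf_op v x hv, h'.leaf_op v x hv]
  · exact ⟨h'.live_summand htop hv x a, by rw [h.prod_op v x a hv, h'.prod_op v x a hv]⟩
  · exact ⟨h'.live_indicator htop hv hM a, by rw [h.indicator_op v a hM, h'.indicator_op v a hM]⟩

/-! ### Simplification -/

theorem addTerminals (h : IsUnrolled B M R w L C) :
    IsUnrolled B M R w (fun v x => C.addTerminals.op (sumNode B.dag v x)) C.addTerminals where
  root_op := by
    change C.addTerminals.op C.root = _
    simp only [Circuit.addTerminals, h.root_op]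
  sum_op v x hv := by
    refine Circuit.addTerminals_op_of_notMem (h.sum_op v x hv)
      (e := (w v x (Classical.arbitrary _), R v x (Classical.arbitrary _)))
      (Multiset.mem_map_of_mem _ (Finset.mem_univ_val _)) fun u y hy => ?_
    rw [h.prod_op v x _ hv] at hy
    cases hy
  prod_op v x a hv := by simp only [Circuit.addTerminals, h.prod_op v x a hv]
  indicator_op v a hv := by simp only [Circuit.addTerminals, h.indicator_op v a hv]
  leaf_op _ _ _ := rfl

theorem addTerminals_of_allTerminal (h : IsUnrolled B M R w L C) (hL : AllTerminal B L) :
    IsUnrolled B M R w L C.addTerminals :=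
  { h.addTerminals with
    leaf_op := fun v x hv => by
      obtain ⟨p, hp⟩ := hL v x hv
      simp only [Circuit.addTerminals, h.leaf_op v x hv, hp] }

theorem allTerminal_addTerminals (hM : ∀ v ∈ M, B.Internal v) (h : IsUnrolled B M R w L C)
    (hL : ∀ v x, ¬ B.Internal v → (∃ p, L v x = .terminal v p) ∨
      L v x = .sum (Finset.univ.val.map fun a => (w v x a, .indicator v a))) :
    AllTerminal B fun v x => C.addTerminals.op (sumNode B.dag v x) := by
  intro v x hv
  rcases hL v x hv with ⟨p, hp⟩ | hp
  · exact ⟨p, by simp only [Circuit.addTerminals, h.leaf_op v x hv, hp]⟩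
  · refine Circuit.addTerminals_op_of_indicators ((h.leaf_op v x hv).trans hp) ?_ ?_
    · rw [Ne, Multiset.map_eq_zero, Finset.val_eq_zero]
      exact Finset.univ_nonempty.ne_empty
    · intro e he
      obtain ⟨a, -, rfl⟩ := Multiset.mem_map.1 he
      exact ⟨a, h.indicator_op v a fun hv' => hv (hM v hv')⟩

/-- No product of the circuit has a product among its factors, so that the second operation does
not change anything. -/
theorem removeProductsOfProducts (h : IsUnrolled B M R w L C) (hL : AllTerminal B L) :
    IsUnrolled B M R w L C.removeProductsOfProducts where
  root_op := by
    refine Circuit.removeProductsOfProducts_op_of_prod h.root_op fun m hm => ?_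
    obtain ⟨r, -, rfl⟩ := List.mem_map.1 hm
    exact h.not_isProd_sumNode hL _ _
  sum_op v x hv := by simp only [Circuit.removeProductsOfProducts, h.sum_op v x hv]
  prod_op v x a hv := by
    refine Circuit.removeProductsOfProducts_op_of_prod (h.prod_op v x a hv) fun m hm => ?_
    rcases mem_summandFactors.1 hm with ⟨c, -, rfl⟩ | ⟨hM, rfl⟩
    · exact h.not_isProd_sumNode hL _ _
    · exact h.not_isProd_indicator hM
  indicator_op v a hv := by simp only [Circuit.removeProductsOfProducts, h.indicator_op v a hv]
  leaf_op v x hv := by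
    obtain ⟨p, hp⟩ := hL v x hv
    simp only [Circuit.removeProductsOfProducts, h.leaf_op v x hv, hp]

theorem isProd_root (h : IsUnrolled B M R w L C) : C.IsProd C.root := ⟨_, h.root_op⟩

theorem isProd_summand (h : IsUnrolled B M R w L C) {v : V} (hv : B.Internal v) (x : ∀ v, Val v)
    (a : Val v) : C.IsProd (R v x a) := ⟨_, h.prod_op v x a hv⟩

/-- The factors of the products of the circuit are their own representatives. -/
theorem map_rep_eq (h : IsUnrolled B M R w L C) (hL : AllTerminal B L)
    {ch : Multiset (ACNode Val B.dag)} {n : ACNode Val B.dag} (hn : C.op n = .prod ch)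
    (hn' : n = C.root ∨ ∃ v x a, B.Internal v ∧ n = R v x a) : ch.map C.rep = ch := by
  have key : ∀ m ∈ ch, ¬ C.IsProd m := by
    intro m hm
    have hc := (Circuit.isChild_of_prod hn).2 hm
    rcases hn' with rfl | ⟨v, x, a, hv, rfl⟩
    · obtain ⟨r, -, rfl⟩ := h.isChild_root.1 hc
      exact h.not_isProd_sumNode hL _ _
    · rcases (h.isChild_summand hv).1 hc with ⟨c, -, rfl⟩ | ⟨hM, rfl⟩
      · exact h.not_isProd_sumNode hL _ _
      · exact h.not_isProd_indicator hM
  conv_rhs => rw [← Multiset.map_id ch]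
  exact Multiset.map_congr rfl fun m hm => Circuit.rep_of_not_isProd (key m hm)

theorem lumpProducts_op_rep (h : IsUnrolled B M R w L C) (hL : AllTerminal B L)
    {n : ACNode Val B.dag} (hl : C.Live n) (hn : n = C.root ∨ ∃ v x a, B.Internal v ∧ n = R v x a) :
    C.lumpProducts.op (C.rep n) = C.op n := by
  have hp : C.IsProd n := by
    rcases hn with rfl | ⟨v, x, a, hv, rfl⟩
    · exact h.isProd_root
    · exact h.isProd_summand hv x a
  obtain ⟨ch, hch⟩ := hp
  simp only [Circuit.lumpProducts, (Circuit.rep_spec hl ⟨ch, hch⟩).2, hch]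
  rw [h.map_rep_eq hL hch hn]

theorem lumpProducts (htop : B.IsTopological) (h : IsUnrolled B M R w L C)
    (hL : AllTerminal B L) :
    IsUnrolled B M (fun v x a => C.rep (R v x a)) w L C.lumpProducts where
  root_op := (h.lumpProducts_op_rep hL .refl (Or.inl rfl)).trans h.root_op
  sum_op v x hv := by
    simp only [Circuit.lumpProducts, h.sum_op v x hv, Multiset.map_map, Function.comp_def]
  prod_op v x a hv :=
    (h.lumpProducts_op_rep hL (h.live_summand htop hv x a) (Or.inr ⟨v, x, a, hv, rfl⟩)).trans
      (h.prod_op v x a hv)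
  indicator_op v a hv := by simp only [Circuit.lumpProducts, h.indicator_op v a hv]
  leaf_op v x hv := by
    obtain ⟨p, hp⟩ := hL v x hv
    simp only [Circuit.lumpProducts, h.leaf_op v x hv, hp]

theorem isLumped_lumpProducts (htop : B.IsTopological) (h : IsUnrolled B M R w L C)
    (hL : AllTerminal B L) : C.lumpProducts.IsLumped := by
  have h' := h.lumpProducts htop hL
  have key : ∀ n, C.lumpProducts.Live n → C.lumpProducts.IsProd n →
      ∃ n₀, C.Live n₀ ∧ C.IsProd n₀ ∧ n = C.rep n₀ ∧ C.lumpProducts.op n = C.op n₀ := by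
    intro n hl hp
    rcases h'.live_cases hL hl with
      rfl | ⟨v, x, rfl⟩ | ⟨v, x, a, hv, rfl⟩ | ⟨v, a, hv, hM, rfl⟩
    · exact ⟨C.root, .refl, h.isProd_root, rfl, h.lumpProducts_op_rep hL .refl (Or.inl rfl)⟩
    · exact absurd hp (h'.not_isProd_sumNode hL v x)
    · exact ⟨R v x a, h.live_summand htop hv x a, h.isProd_summand hv x a, rfl,
        h.lumpProducts_op_rep hL (h.live_summand htop hv x a) (Or.inr ⟨v, x, a, hv, rfl⟩)⟩
    · exact absurd hp (h'.not_isProd_indicator hM)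
  intro m n hm hn hp hop
  obtain ⟨m₀, hm₀, hpm, rfl, hm⟩ := key m hm hp
  obtain ⟨n₀, hn₀, -, rfl, hn⟩ := key n hn (by rwa [Circuit.IsProd, ← hop])
  exact Circuit.rep_eq_of_op_eq hm₀ hn₀ hpm (by rw [← hm, ← hn, hop])

theorem isLumped_of_unrolled (htop : B.IsTopological) (h : IsUnrolled B M R w L C)
    (hL : AllTerminal B L) (h' : IsUnrolled B M R w L D) (hroot : C.root = D.root)
    (hD : D.IsLumped) : C.IsLumped := by
  intro m n hm hn hp hop
  obtain ⟨hm', hmop⟩ := h.live_and_op_eq htop hL h' hroot hm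
  obtain ⟨hn', hnop⟩ := h.live_and_op_eq htop hL h' hroot hn
  refine hD m n hm' hn' ?_ ?_
  · rwa [Circuit.IsProd, ← hmop]
  · rw [← hmop, ← hnop, hop]

/-- One pass of the simplification loop turns the sums over indicators into terminal nodes and
leaves no two products with the same factors. Nothing else changes. -/
theorem simplifyPass (htop : B.IsTopological) (hM : ∀ v ∈ M, B.Internal v)
    (h : IsUnrolled B M R w L C)
    (hL : ∀ v x, ¬ B.Internal v → (∃ p, L v x = .terminal v p) ∨
      L v x = .sum (Finset.univ.val.map fun a => (w v x a, .indicator v a))) :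
    ∃ R' L', IsUnrolled B M R' w L' C.simplifyPass ∧ AllTerminal B L' ∧
      C.simplifyPass.IsLumped := by
  have hL' := h.allTerminal_addTerminals hM hL
  have h' := h.addTerminals.removeProductsOfProducts hL'
  exact ⟨_, _, h'.lumpProducts htop hL', hL', h'.isLumped_lumpProducts htop hL'⟩

/-- What the first pass returns is a fixed point of the pass. -/
theorem same_simplifyPass (htop : B.IsTopological) (h : IsUnrolled B M R w L C)
    (hL : AllTerminal B L) (hC : C.IsLumped) : Circuit.Same C.simplifyPass C := by
  have h' := (h.addTerminals_of_allTerminal hL).removeProductsOfProducts hL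
  have hlump : C.addTerminals.removeProductsOfProducts.IsLumped :=
    isLumped_of_unrolled htop h' hL h rfl hC
  rw [Circuit.simplifyPass, hlump.lumpProducts_eq]
  exact ⟨rfl, fun n hn => (h'.live_and_op_eq htop hL h rfl hn).2⟩

/-- Whatever the simplification loop returns is the result of a pass, and hence of the final
shape. -/
theorem of_simplifies (htop : B.IsTopological) (hM : ∀ v ∈ M, B.Internal v)
    (h : IsUnrolled B M R w L C)
    (hL : ∀ v x, ¬ B.Internal v → (∃ p, L v x = .terminal v p) ∨
      L v x = .sum (Finset.univ.val.map fun a => (w v x a, .indicator v a)))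
    (hCD : C.Simplifies D) :
    ∃ R' L', IsUnrolled B M R' w L' D ∧ AllTerminal B L' := by
  induction hCD generalizing R L with
  | unchanged C _ =>
    obtain ⟨R', L', h', hL', -⟩ := h.simplifyPass htop hM hL
    exact ⟨R', L', h', hL'⟩
  | changed C D _ _ ih =>
    obtain ⟨R', L', h', hL', -⟩ := h.simplifyPass htop hM hL
    exact ih h' fun v x hv => Or.inl (hL' v x hv)

theorem exists_simplifies (htop : B.IsTopological) (hM : ∀ v ∈ M, B.Internal v)
    (h : IsUnrolled B M R w L C)
    (hL : ∀ v x, ¬ B.Internal v → (∃ p, L v x = .terminal v p) ∨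
      L v x = .sum (Finset.univ.val.map fun a => (w v x a, .indicator v a))) :
    ∃ D, C.Simplifies D := by
  obtain ⟨R', L', h', hL', hlump⟩ := h.simplifyPass htop hM hL
  by_cases hs : Circuit.Same C.simplifyPass C
  · exact ⟨_, .unchanged C hs⟩
  · exact ⟨_, .changed C _ hs (.unchanged _ (h'.same_simplifyPass htop hL' hlump))⟩

end IsUnrolled

/-! ### The compiled circuit before simplification -/

variable (B : BayesNet V Val)

theorem compileAC_op_mulEntry (fs : List (Factor Val B.dag)) (x : ∀ v, Val v) :
    (compileAC B).op (Factor.mulEntry fs x) =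
      .prod (fs.map fun φ => φ.entry x : List (ACNode Val B.dag)) := by
  change Op.prod _ = _
  congr 1
  rw [Fin.univ_val_map]
  congr 1
  exact List.ofFn_getElem_eq_map fs fun φ => φ.entry x

theorem not_isParam_sumNode (v : V) (x : ∀ v, Val v) :
    ¬ (compileAC B).IsParam (sumNode B.dag v x) := by
  rintro ⟨r, hr⟩
  rw [sumNode_eq] at hr
  cases hr

theorem redistribute_op_sumNode (v : V) (x : ∀ v, Val v) :
    (compileAC B).redistribute.op (sumNode B.dag v x) = .sum (Finset.univ.val.map fun a =>
      (compileAC B).redistributeEdge (1, prodNode B.dag v x a)) := by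
  have h : (compileAC B).op (sumNode B.dag v x) =
      .sum (Finset.univ.val.map fun a => (1, prodNode B.dag v x a)) := by
    rw [sumNode_eq]
    rfl
  simp only [Circuit.redistribute, h, Multiset.map_map, Function.comp_def]

/-- The non-numeric factors of a summand. -/
noncomputable def symbolicFactors (v : V) (x : ∀ v, Val v) (a : Val v) :
    List (ACNode Val B.dag) :=
  ((elimChildren B.dag v).map fun c => sumNode B.dag c (Function.update x v a)) ++
    [.indicator v a]

open Classical in
theorem filter_factors_prodNode (v : V) (x : ∀ v, Val v) (a : Val v) :
    ((compileAC B).factors (prodNode B.dag v x a)).filter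
      (fun n => ¬ (compileAC B).IsParam n) = symbolicFactors B v x a := by
  have h1 : ¬ (compileAC B).IsParam (.indicator v a) := by
    rintro ⟨r, hr⟩
    cases hr
  have h2 : ∀ p, (compileAC B).IsParam (.param v a p) := fun p => ⟨_, rfl⟩
  have h3 : ((elimChildren B.dag v).map fun c =>
      sumNode B.dag c (Function.update x v a)).filter (fun n => ¬ (compileAC B).IsParam n) =
      (elimChildren B.dag v).map fun c => sumNode B.dag c (Function.update x v a) := by
    rw [List.filter_eq_self]
    intro n hn
    obtain ⟨c, -, rfl⟩ := List.mem_map.1 hn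
    simpa using not_isParam_sumNode B _ _
  rw [prodNode, Circuit.factors, compileAC_op_mulEntry]
  simp only [bucket, List.map_append, List.map_map, Function.comp_def, Multiset.filter_coe,
    List.filter_append]
  change ((List.filter _ (List.map (fun c => sumNode B.dag c (Function.update x v a)) _) ++ _ :
    List (ACNode Val B.dag)) : Multiset (ACNode Val B.dag)) = _
  rw [h3]
  simp [symbolicFactors, Factor.ofIndicator, Factor.ofCPT, h1, h2]

theorem compileAC_op_prodNode (v : V) (x : ∀ v, Val v) (a : Val v) :
    (compileAC B).op (prodNode B.dag v x a) =
      .prod ((compileAC B).factors (prodNode B.dag v x a)) := by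
  rw [Circuit.factors, prodNode, compileAC_op_mulEntry]

/-- A variable without children has no other factor than its indicator, to which the edge then
leads. -/
theorem redistributeEdge_prodNode (htop : B.IsTopological) (v : V) (x : ∀ v, Val v) (a : Val v) :
    (B.Internal v →
      ((compileAC B).redistributeEdge (1, prodNode B.dag v x a)).2 = prodNode B.dag v x a) ∧
    (¬ B.Internal v →
      ((compileAC B).redistributeEdge (1, prodNode B.dag v x a)).2 = .indicator v a) := by
  classical
  simp only [Circuit.redistributeEdge, compileAC_op_prodNode]
  have hf := filter_factors_prodNode B v x a
  constructor
  · intro hv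
    obtain ⟨c, hc⟩ := (exists_elimChild_iff htop).2 hv
    rw [dif_neg]
    rintro ⟨m, hm⟩
    rw [hf] at hm
    have h := congrArg Multiset.card hm
    have h' := List.length_pos_of_mem (mem_elimChildren.2 hc)
    simp only [symbolicFactors, Multiset.coe_card, List.length_append, List.length_map,
      List.length_singleton, Multiset.card_singleton] at h
    omega
  · intro hv
    have hnil : elimChildren B.dag v = [] :=
      List.eq_nil_iff_forall_not_mem.2 fun c hc =>
        hv ((exists_elimChild_iff htop).1 ⟨c, mem_elimChildren.1 hc⟩)
    have h : ((symbolicFactors B v x a : List (ACNode Val B.dag)) :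
        Multiset (ACNode Val B.dag)) = {.indicator v a} := by
      simp [symbolicFactors, hnil]
    have hex : ∃ m, ((compileAC B).factors (prodNode B.dag v x a)).filter
        (fun n => ¬ (compileAC B).IsParam n) = {m} := ⟨_, hf.trans h⟩
    rw [dif_pos hex]
    exact (Multiset.singleton_inj.1 ((hf.trans h).symm.trans hex.choose_spec)).symm

/-- The circuit to which the simplification is applied. -/
theorem isUnrolled_compileAC (htop : B.IsTopological) (M : Set V) :
    IsUnrolled B M (prodNode B.dag)
      (fun v x a => ((compileAC B).redistributeEdge (1, prodNode B.dag v x a)).1)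
      (fun v x => .sum (Finset.univ.val.map fun a =>
        (((compileAC B).redistributeEdge (1, prodNode B.dag v x a)).1, .indicator v a)))
      ((compileAC B).redistribute.marginalize M) := by
  classical
  have hsum : ∀ v x, ((compileAC B).redistribute.marginalize M).op (sumNode B.dag v x) =
      .sum (Finset.univ.val.map fun a =>
        (compileAC B).redistributeEdge (1, prodNode B.dag v x a)) := by
    intro v x
    simp only [Circuit.marginalize, redistribute_op_sumNode]
  have hnot : ∀ c x, ∀ v ∈ M, ∀ y,
      (compileAC B).redistribute.op (sumNode B.dag c x) ≠ .indicator v y := by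
    intro c x v _ y hy
    rw [redistribute_op_sumNode] at hy
    cases hy
  have hind : ∀ v a, (compileAC B).redistribute.op (.indicator v a) = .indicator v a :=
    fun _ _ => rfl
  refine ⟨?_, ?_, ?_, ?_, ?_⟩
  · have h : (compileAC B).op (compileAC B).root = .prod ((elimRoots B.dag).map fun r =>
        sumNode B.dag r fun v => Classical.arbitrary (Val v) : List (ACNode Val B.dag)) := by
      rw [compileAC_root B htop, compileAC_op_mulEntry, List.map_map]
      rfl
    refine Circuit.marginalize_op_of_prod (ch' := 0) ?_ ?_ (by simp)
    · change (compileAC B).redistribute.op (compileAC B).root = _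
      simp only [Circuit.redistribute, h]
      rw [add_zero, Multiset.filter_eq_self.2]
      intro n hn
      obtain ⟨r, -, rfl⟩ := List.mem_map.1 hn
      exact not_isParam_sumNode B _ _
    · intro n hn
      obtain ⟨r, -, rfl⟩ := List.mem_map.1 hn
      exact hnot _ _
  · intro v x hv
    rw [hsum]
    congr 1
    refine Multiset.map_congr rfl fun a _ => Prod.ext rfl ?_
    exact (redistributeEdge_prodNode B htop v x a).1 hv
  · intro v x a _
    have h : (compileAC B).redistribute.op (prodNode B.dag v x a) =
        .prod (symbolicFactors B v x a : List (ACNode Val B.dag)) := by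
      simp only [Circuit.redistribute, compileAC_op_prodNode, filter_factors_prodNode]
    by_cases hv : v ∈ M
    · refine Circuit.marginalize_op_of_prod (ch' := {.indicator v a}) ?_ ?_ ?_
      · rw [h, symbolicFactors, ← Multiset.coe_add, summandFactors, if_pos hv, add_zero]
        rfl
      · intro n hn
        rcases mem_summandFactors.1 hn with ⟨c, -, rfl⟩ | ⟨hv', -⟩
        · exact hnot _ _
        · exact absurd hv hv'
      · intro n hn
        rw [Multiset.mem_singleton.1 hn]
        exact ⟨v, hv, a, hind v a⟩
    · refine Circuit.marginalize_op_of_prod (ch' := 0) ?_ ?_ (by simp)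
      · rw [h, symbolicFactors, ← Multiset.coe_add, summandFactors, if_neg hv, add_zero]
        rfl
      · intro n hn u hu y hy
        rcases mem_summandFactors.1 hn with ⟨c, -, rfl⟩ | ⟨-, rfl⟩
        · exact hnot _ _ u hu y hy
        · rw [hind] at hy
          exact hv ((Op.indicator.inj hy).1 ▸ hu)
  · intro v a hv
    simp only [Circuit.marginalize, hind, if_neg hv]
  · intro v x hv
    rw [hsum]
    congr 1
    refine Multiset.map_congr rfl fun a _ => Prod.ext rfl ?_
    exact (redistributeEdge_prodNode B htop v x a).2 hv

theorem exists_BN2SPN (htop : B.IsTopological) {M : Set V} (hM : ∀ v ∈ M, B.Internal v) :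
    ∃ S, BN2SPN B M S :=
  (isUnrolled_compileAC B htop M).exists_simplifies htop hM fun _ _ _ => Or.inr rfl

theorem isUnrolled_of_BN2SPN (htop : B.IsTopological) {M : Set V} (hM : ∀ v ∈ M, B.Internal v)
    {S : Circuit Val (ACNode Val B.dag)} (hS : BN2SPN B M S) :
    ∃ R w L, IsUnrolled B M R w L S ∧ AllTerminal B L := by
  obtain ⟨R, L, h, hL⟩ :=
    (isUnrolled_compileAC B htop M).of_simplifies htop hM (fun _ _ _ => Or.inr rfl) hS
  exact ⟨R, _, L, h, hL⟩

end Unrolled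

/-! ### Reachability in augmented networks -/

namespace Circuit

variable {V : Type*} {Val : V → Type*} {N : Type*} {C : Circuit Val N}

theorem IsChild.isSum_or_isProd {n c : N} (h : C.IsChild n c) : C.IsSum n ∨ C.IsProd n := by
  unfold IsChild at h
  split at h
  · exact Or.inl ⟨_, ‹_›⟩
  · exact Or.inr ⟨_, ‹_›⟩
  · exact h.elim

theorem not_isProd_of_isSum {n : N} (h : C.IsSum n) : ¬ C.IsProd n := by
  rintro ⟨ch, hch⟩
  obtain ⟨ch', hch'⟩ := h
  rw [hch] at hch'
  cases hch'

theorem augReach_orig_of_reach {m n : N} (h : C.Reach m n) : C.AugReach (.orig m) (.orig n) := by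
  induction h with
  | refl => exact .refl
  | tail _ hc ih =>
    rcases hc.isSum_or_isProd with hs | hp
    · exact (ih.tail (.sum hs hc)).tail (.link hs hc)
    · exact ih.tail (.prod hp hc)

theorem augReach_link_orig {s c n : N} (hs : C.IsSum s) (hc : C.IsChild s c) :
    C.AugReach (.link s c) (.orig n) ↔ C.Reach c n := by
  refine ⟨fun h => ?_, fun h => .head (.link hs hc) (augReach_orig_of_reach h)⟩
  have key : ∀ d, C.AugReach d (.orig n) →
      match d with
      | .orig m => C.Reach m n
      | .link _ c => C.Reach c n
      | _ => False := by
    intro d hd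
    induction hd using ReflTransGen.head_induction_on with
    | refl => exact .refl
    | head h _ ih =>
      cases h with
      | prod _ hc => exact .head hc ih
      | sum _ hc => exact .head hc ih
      | link _ _ => exact ih
      | select _ _ => exact ih.elim
      | linkTwin _ _ _ _ _ => exact ih.elim
      | twin _ _ => exact ih.elim
  exact key _ h

/-- The twin of `t` is a factor of the link from `s` to `c`. -/
def Skips (C : Circuit Val N) (s c t : N) : Prop :=
  C.IsSum s ∧ C.IsChild s c ∧ C.IsSum t ∧ C.IsAncestor s t ∧ ¬ C.Reach c t

/-- A link reaches a twin directly or through a link further down. -/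
theorem augReach_link_twin {s c t : N} (hs : C.IsSum s) (hc : C.IsChild s c) :
    C.AugReach (.link s c) (.twin t) ↔
      C.Skips s c t ∨ ∃ s' c', C.Reach c s' ∧ C.Skips s' c' t := by
  constructor
  · intro h
    have key : ∀ d, C.AugReach d (.twin t) →
        match d with
        | .orig m => ∃ s' c', C.Reach m s' ∧ C.Skips s' c' t
        | .link s c => C.Skips s c t ∨ ∃ s' c', C.Reach c s' ∧ C.Skips s' c' t
        | .select _ _ => False
        | .twin s => s = t := by
      intro d hd
      induction hd using ReflTransGen.head_induction_on with
      | refl => rfl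
      | head h _ ih =>
        cases h with
        | prod _ hc =>
          obtain ⟨s', c', h1, h2⟩ := ih
          exact ⟨s', c', .head hc h1, h2⟩
        | sum hs hc =>
          rcases ih with h2 | ⟨s', c', h1, h2⟩
          · exact ⟨_, _, .refl, h2⟩
          · exact ⟨s', c', .head hc h1, h2⟩
        | link _ _ => exact Or.inr ih
        | select _ _ => exact ih.elim
        | linkTwin h1 h2 h3 h4 h5 =>
          subst ih
          exact Or.inl ⟨h1, h2, h3, h4, h5⟩
        | twin _ _ => exact ih.elim
    exact key _ h
  · rintro (⟨h1, h2, h3, h4, h5⟩ | ⟨s', c', hr, h1, h2, h3, h4, h5⟩)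
    · exact .single (.linkTwin h1 h2 h3 h4 h5)
    · exact .head (.link hs hc) ((augReach_orig_of_reach hr).trans
        (.head (.sum h1 h2) (.single (.linkTwin h1 h2 h3 h4 h5))))

theorem augChild_orig_iff {s : N} (hs : C.IsSum s) {d : AugNode N} :
    C.AugChild (.orig s) d ↔ ∃ c, C.IsChild s c ∧ d = .link s c := by
  constructor
  · intro h
    cases h with
    | prod hp _ => exact absurd hp (not_isProd_of_isSum hs)
    | sum _ hc => exact ⟨_, hc, rfl⟩
  · rintro ⟨c, hc, rfl⟩
    exact .sum hs hc

/-- If a child of `s` reaches `n` and another one does not, then `s` is conditioning for `n`. -/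
theorem isConditioning_of_reach {s c c' n : N} (hs : C.IsSum s) (hc : C.IsChild s c)
    (hc' : C.IsChild s c') (hr : C.Reach c n) (hr' : ¬ C.Reach c' n) : C.IsConditioning s n := by
  refine ⟨hs, .head' hc hr, fun h => hr' ?_⟩
  have := (h _ _ (.sum hs hc) (.sum hs hc')).1
  rw [augReach_link_orig hs hc, augReach_link_orig hs hc'] at this
  exact this.1 hr

/-- If all children of `s` reach `n`, then only the twin of `n` can make `s` conditioning. -/
theorem not_isConditioning_of_reach {s n : N} (hr : ∀ c, C.IsChild s c → C.Reach c n)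
    (htwin : ∀ c c', C.IsChild s c → C.IsChild s c' → ∀ s' e, C.Reach c s' → C.Skips s' e n →
      ∃ s' e, C.Reach c' s' ∧ C.Skips s' e n) : ¬ C.IsConditioning s n := by
  rintro ⟨hs, -, h⟩
  refine h ?_
  have key : ∀ c c', C.IsChild s c → C.IsChild s c' → C.AugReach (.link s c) (.twin n) →
      C.AugReach (.link s c') (.twin n) := by
    intro c c' hc hc' h
    rw [augReach_link_twin hs hc] at h
    rw [augReach_link_twin hs hc']
    rcases h with h | ⟨s', e, h1, h2⟩
    · exact absurd (hr c hc) h.2.2.2.2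
    · exact Or.inr (htwin c c' hc hc' s' e h1 h2)
  intro d d' hd hd'
  obtain ⟨c, hc, rfl⟩ := (augChild_orig_iff hs).1 hd
  obtain ⟨c', hc', rfl⟩ := (augChild_orig_iff hs).1 hd'
  rw [augReach_link_orig hs hc, augReach_link_orig hs hc']
  exact ⟨iff_of_true (hr c hc) (hr c' hc'), key _ _ hc hc', key _ _ hc' hc⟩

theorem inScope_iff {v : V} {n : N} :
    C.InScope v n ↔ ∃ m, C.Reach n m ∧ C.IsLeafOf v m := by
  constructor
  · intro h
    induction h with
    | leaf h => exact ⟨_, .refl, h⟩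
    | child hc _ ih =>
      obtain ⟨m, h1, h2⟩ := ih
      exact ⟨m, .head hc h1, h2⟩
  · rintro ⟨m, h1, h2⟩
    induction h1 using ReflTransGen.head_induction_on with
    | refl => exact .leaf h2
    | head hc _ ih => exact .child hc ih

theorem exists_pathSums {n : N} (h : C.Live n) : ∃ k, C.PathSums k n := by
  induction h with
  | refl => exact ⟨0, .root⟩
  | tail _ hc ih =>
    obtain ⟨k, hk⟩ := ih
    rcases hc.isSum_or_isProd with hs | hp
    · exact ⟨k + 1, .sum hk hs hc⟩
    · exact ⟨k, .prod hk hp hc⟩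

theorem sumDepth_eq {n : N} {d : ℕ} (hl : C.Live n) (h : ∀ k, C.PathSums k n → k = d) :
    C.sumDepth n = d := by
  obtain ⟨k, hk⟩ := exists_pathSums hl
  have : {k | C.PathSums k n} = {d} := by
    ext l
    exact ⟨h l, fun hl => by rw [Set.mem_singleton_iff.1 hl, ← h k hk]; exact hk⟩
  rw [sumDepth, this, csSup_singleton]

theorem adj_inl_iff {Z : C.Latent} {b : C.Latent ⊕ C.Observed} :
    (SPN2BN C).Adj (.inl Z) b ↔ ∃ s n, s ∈ Z.1 ∧ C.Represents n b ∧ C.IsConditioning s n :=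
  ⟨fun ⟨_, hZ, h⟩ => Sum.inl.inj hZ ▸ h, fun h => ⟨Z, rfl, h⟩⟩

theorem not_adj_inr {X : C.Observed} {b : C.Latent ⊕ C.Observed} :
    ¬ (SPN2BN C).Adj (.inr X) b := by
  rintro ⟨Z, hZ, -⟩
  cases hZ

end Circuit

/-! ### Reachability and conditioning in the compiled network -/

section Decompilation

variable {V : Type*} [Fintype V] [LinearOrder V] {Val : V → Type*} [∀ v, Fintype (Val v)]
  [∀ v, Nonempty (Val v)]

namespace IsUnrolled

variable {B : BayesNet V Val} {M : Set V} {R : ∀ v, (∀ v, Val v) → Val v → ACNode Val B.dag}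
  {w : ∀ v, (∀ v, Val v) → Val v → ℝ} {L : V → (∀ v, Val v) → Op Val (ACNode Val B.dag)}
  {C : Circuit Val (ACNode Val B.dag)}

theorem isSum_sumNode (h : IsUnrolled B M R w L C) {v : V} (hv : B.Internal v) (x : ∀ v, Val v) :
    C.IsSum (sumNode B.dag v x) := ⟨_, h.sum_op v x hv⟩

theorem summand_ne_sumNode (h : IsUnrolled B M R w L C) (hL : AllTerminal B L) {u : V}
    (hu : B.Internal u) {x : ∀ v, Val v} {a : Val u} {v : V} {y : ∀ v, Val v} :
    R u x a ≠ sumNode B.dag v y :=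
  fun he => h.not_isProd_sumNode hL v y (he ▸ h.isProd_summand hu x a)

theorem summand_ne_indicator (h : IsUnrolled B M R w L C) {u : V}
    (hu : B.Internal u) {x : ∀ v, Val v} {a : Val u} {v : V} (hv : v ∉ M) {b : Val v} :
    R u x a ≠ .indicator v b :=
  fun he => h.not_isProd_indicator hv (he ▸ h.isProd_summand hu x a)

theorem isSum_cases (h : IsUnrolled B M R w L C) (hL : AllTerminal B L)
    {n : ACNode Val B.dag} (hn : C.Live n) (hs : C.IsSum n) :
    ∃ v x, B.Internal v ∧ n = sumNode B.dag v x := by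
  rcases h.live_cases hL hn with rfl | ⟨v, x, rfl⟩ | ⟨v, x, a, hv, rfl⟩ | ⟨v, a, hv, hM, rfl⟩
  · exact absurd h.isProd_root (Circuit.not_isProd_of_isSum hs)
  · by_cases hv : B.Internal v
    · exact ⟨v, x, hv, rfl⟩
    · obtain ⟨p, hp⟩ := hL v x hv
      obtain ⟨ch, hch⟩ := hs
      rw [h.leaf_op v x hv, hp] at hch
      cases hch
  · exact absurd (h.isProd_summand hv x a) (Circuit.not_isProd_of_isSum hs)
  · obtain ⟨ch, hch⟩ := hs
    rw [h.indicator_op v a hM] at hch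
    cases hch

theorem isLeafOf_cases (h : IsUnrolled B M R w L C) (hL : AllTerminal B L)
    {n : ACNode Val B.dag} (hn : C.Live n) {v : V} (hv : C.IsLeafOf v n) :
    (¬ B.Internal v ∧ ∃ x, n = sumNode B.dag v x) ∨
      B.Internal v ∧ v ∉ M ∧ ∃ a, n = .indicator v a := by
  rcases h.live_cases hL hn with rfl | ⟨u, x, rfl⟩ | ⟨u, x, a, hu, rfl⟩ | ⟨u, a, hu, hM, rfl⟩
  · simp [Circuit.IsLeafOf, h.root_op] at hv
  · by_cases hu : B.Internal u
    · simp [Circuit.IsLeafOf, h.sum_op u x hu] at hv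
    · obtain ⟨p, hp⟩ := hL u x hu
      simp only [Circuit.IsLeafOf, h.leaf_op u x hu, hp] at hv
      rcases hv with ⟨y, hy⟩ | ⟨q, hq⟩
      · cases hy
      · obtain rfl := (Op.terminal.inj hq).1
        exact Or.inl ⟨hu, x, rfl⟩
  · simp [Circuit.IsLeafOf, h.prod_op u x a hu] at hv
  · simp only [Circuit.IsLeafOf, h.indicator_op u a hM] at hv
    rcases hv with ⟨y, hy⟩ | ⟨q, hq⟩
    · obtain rfl := (Op.indicator.inj hy).1
      exact Or.inr ⟨hu, hM, a, rfl⟩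
    · cases hq

theorem isLeafOf_sumNode (h : IsUnrolled B M R w L C) (hL : AllTerminal B L) {v : V}
    (hv : ¬ B.Internal v) (x : ∀ v, Val v) : C.IsLeafOf v (sumNode B.dag v x) := by
  obtain ⟨p, hp⟩ := hL v x hv
  exact Or.inr ⟨p, (h.leaf_op v x hv).trans hp⟩

theorem isLeafOf_indicator (h : IsUnrolled B M R w L C) {v : V} (hv : v ∉ M) (a : Val v) :
    C.IsLeafOf v (.indicator v a) :=
  Or.inl ⟨a, h.indicator_op v a hv⟩

theorem reach_sumNode_cases (h : IsUnrolled B M R w L C) (hL : AllTerminal B L) {u : V}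
    {x : ∀ v, Val v} {m : ACNode Val B.dag} (hm : C.Reach (sumNode B.dag u x) m) :
    m = sumNode B.dag u x ∨ B.Internal u ∧ ∃ a, C.Reach (R u x a) m := by
  rcases ReflTransGen.cases_head hm with hm | ⟨c, hc, hm⟩
  · exact Or.inl hm.symm
  · by_cases hu : B.Internal u
    · obtain ⟨a, rfl⟩ := (h.isChild_sumNode hu).1 hc
      exact Or.inr ⟨hu, a, hm⟩
    · exact absurd hc (h.not_isChild_leaf hL hu)

theorem reach_summand_cases (h : IsUnrolled B M R w L C) {u : V} (hu : B.Internal u)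
    {x : ∀ v, Val v} {a : Val u} {m : ACNode Val B.dag} (hm : C.Reach (R u x a) m) :
    m = R u x a ∨
      (∃ c, ElimChild B.dag u c ∧ C.Reach (sumNode B.dag c (Function.update x u a)) m) ∨
      u ∉ M ∧ m = .indicator u a := by
  rcases ReflTransGen.cases_head hm with hm | ⟨c, hc, hm⟩
  · exact Or.inl hm.symm
  · rcases (h.isChild_summand hu).1 hc with ⟨d, hd, rfl⟩ | ⟨hM, rfl⟩
    · exact Or.inr (Or.inl ⟨d, hd, hm⟩)
    · rcases ReflTransGen.cases_head hm with hm | ⟨c, hc, -⟩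
      · exact Or.inr (Or.inr ⟨hM, hm.symm⟩)
      · exact absurd hc (h.not_isChild_indicator hM)

theorem reach_sumNode_self (htop : B.IsTopological) (h : IsUnrolled B M R w L C) {u v : V}
    (huv : ReflTransGen (ElimChild B.dag) u v) (x : ∀ v, Val v) :
    C.Reach (sumNode B.dag u x) (sumNode B.dag v x) := by
  induction huv with
  | refl => exact .refl
  | @tail b c _ hbc ih =>
    have hb := internal_of_elimChild htop hbc
    refine (ih.tail ((h.isChild_sumNode hb).2 ⟨x b, rfl⟩)).tail
      ((h.isChild_summand hb).2 (Or.inl ⟨c, hbc, ?_⟩))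
    rw [Function.update_eq_self]

theorem of_reach_sumNode (htop : B.IsTopological) (h : IsUnrolled B M R w L C)
    (hL : AllTerminal B L) {u v : V} {x y : ∀ v, Val v}
    (hr : C.Reach (sumNode B.dag u x) (sumNode B.dag v y)) :
    ReflTransGen (ElimChild B.dag) u v ∧
      ∀ q, (moralClosure B.dag).Adj q v → q < u → y q = x q := by
  induction u using WellFoundedGT.induction generalizing x with
  | ind u ih =>
    rcases h.reach_sumNode_cases hL hr with he | ⟨hu, a, hr⟩
    · obtain rfl := eq_of_sumNode_eq he
      exact ⟨.refl, fun q hq _ => sumNode_inj htop he hq⟩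
    · rcases h.reach_summand_cases hu hr with he | ⟨c, hc, hr⟩ | ⟨-, he⟩
      · exact absurd he.symm (h.summand_ne_sumNode hL hu)
      · obtain ⟨h1, h2⟩ := ih c hc.1 hr
        refine ⟨.head hc h1, fun q hq hqu => ?_⟩
        rw [h2 q hq (hqu.trans hc.1), Function.update_of_ne hqu.ne]
      · exact absurd he sumNode_ne_indicator

/-- The summand of the sum node of `u` for the value `a` reaches the sum nodes of the variables
`v` below `u` whose parents above `u` have the same values, and whose parent `u`, if it is one,
has the value `a`. -/
theorem reach_summand_iff (htop : B.IsTopological) (h : IsUnrolled B M R w L C)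
    (hL : AllTerminal B L) {u v : V} (hu : B.Internal u) {x y : ∀ v, Val v} {a : Val u} :
    C.Reach (R u x a) (sumNode B.dag v y) ↔ TransGen (ElimChild B.dag) u v ∧
      (∀ q, (moralClosure B.dag).Adj q v → q < u → y q = x q) ∧
      ((moralClosure B.dag).Adj u v → y u = a) := by
  constructor
  · intro hr
    rcases h.reach_summand_cases hu hr with he | ⟨c, hc, hr⟩ | ⟨-, he⟩
    · exact absurd he.symm (h.summand_ne_sumNode hL hu)
    · obtain ⟨h1, h2⟩ := h.of_reach_sumNode htop hL hr
      refine ⟨.head' hc h1, fun q hq hqu => ?_, fun huv => ?_⟩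
      · rw [h2 q hq (hqu.trans hc.1), Function.update_of_ne hqu.ne]
      · rw [h2 u huv hc.1, Function.update_self]
    · exact absurd he sumNode_ne_indicator
  · rintro ⟨huv, h1, h2⟩
    obtain ⟨c, hc, hcv⟩ := TransGen.head'_iff.1 huv
    -- an assignment that agrees with both sides on what they depend on
    let z : ∀ v, Val v := Function.update (fun q => if q < u then x q else y q) u a
    have hz : ∀ q, q < u → z q = x q := by
      intro q hq
      simp [z, Function.update_of_ne hq.ne, hq]
    have hzu : z u = a := Function.update_self _ _ _
    have hz' : ∀ q, u < q → z q = y q := by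
      intro q hq
      simp [z, Function.update_of_ne hq.ne', hq.le]
    have e1 : sumNode B.dag c (Function.update x u a) = sumNode B.dag c z := by
      refine sumNode_congr htop fun q hq => ?_
      rcases (hc.2.2 q hq).eq_or_lt with rfl | hqu
      · rw [Function.update_self, hzu]
      · rw [Function.update_of_ne hqu.ne, hz q hqu]
    have e2 : sumNode B.dag v y = sumNode B.dag v z := by
      refine sumNode_congr htop fun q hq => ?_
      rcases lt_trichotomy q u with hqu | rfl | hqu
      · rw [h1 q hq hqu, hz q hqu]
      · rw [h2 hq, hzu]
      · exact (hz' q hqu).symm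
    have hr := h.reach_sumNode_self htop hcv z
    rw [← e1, ← e2] at hr
    exact .head ((h.isChild_summand hu).2 (Or.inl ⟨c, hc, rfl⟩)) hr

theorem isAncestor_sumNode_iff (htop : B.IsTopological) (h : IsUnrolled B M R w L C)
    (hL : AllTerminal B L) {u v : V} (hu : B.Internal u) {x y : ∀ v, Val v} :
    C.IsAncestor (sumNode B.dag u x) (sumNode B.dag v y) ↔ TransGen (ElimChild B.dag) u v ∧
      ∀ q, (moralClosure B.dag).Adj q v → q < u → y q = x q := by
  rw [Circuit.IsAncestor, TransGen.head'_iff]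
  constructor
  · rintro ⟨c, hc, hr⟩
    obtain ⟨a, rfl⟩ := (h.isChild_sumNode hu).1 hc
    obtain ⟨h1, h2, -⟩ := (h.reach_summand_iff htop hL hu).1 hr
    exact ⟨h1, h2⟩
  · rintro ⟨h1, h2⟩
    exact ⟨R u x (y u), (h.isChild_sumNode hu).2 ⟨_, rfl⟩,
      (h.reach_summand_iff htop hL hu).2 ⟨h1, h2, fun _ => rfl⟩⟩

/-- A sum node of `u` is conditioning for the sum nodes and terminal nodes of `v` below it if and
only if `u` is a parent of `v` in the moral closure. -/
theorem isConditioning_sumNode_iff (htop : B.IsTopological)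
    (hval : ∀ v, B.Internal v → Nontrivial (Val v)) (h : IsUnrolled B M R w L C)
    (hL : AllTerminal B L) {u v : V} (hu : B.Internal u) {x y : ∀ v, Val v} :
    C.IsConditioning (sumNode B.dag u x) (sumNode B.dag v y) ↔
      C.IsAncestor (sumNode B.dag u x) (sumNode B.dag v y) ∧ (moralClosure B.dag).Adj u v := by
  have hs := h.isSum_sumNode hu x
  constructor
  · intro hcond
    refine ⟨hcond.2.1, ?_⟩
    obtain ⟨huv, hyx⟩ := (h.isAncestor_sumNode_iff htop hL hu).1 hcond.2.1
    revert hcond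
    contrapose
    intro hadj
    have hr : ∀ a, C.Reach (R u x a) (sumNode B.dag v y) := fun a =>
      (h.reach_summand_iff htop hL hu).2 ⟨huv, hyx, fun h' => absurd h' hadj⟩
    refine Circuit.not_isConditioning_of_reach (fun c hc => ?_) ?_
    · obtain ⟨a, rfl⟩ := (h.isChild_sumNode hu).1 hc
      exact hr a
    · intro c c' hc hc' s' e hs' hskip
      obtain ⟨a, rfl⟩ := (h.isChild_sumNode hu).1 hc
      obtain ⟨a', rfl⟩ := (h.isChild_sumNode hu).1 hc'
      obtain ⟨hsum, he, ht, hanc, hnr⟩ := hskip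
      have hlive : C.Live s' := (h.live_summand htop hu x a).trans hs'
      obtain ⟨t, z, hti, rfl⟩ := h.isSum_cases hL hlive hsum
      obtain ⟨b, rfl⟩ := (h.isChild_sumNode hti).1 he
      obtain ⟨htv, hyz⟩ := (h.isAncestor_sumNode_iff htop hL hti).1 hanc
      obtain ⟨hut, -, -⟩ := (h.reach_summand_iff htop hL hu).1 hs'
      have htb : (moralClosure B.dag).Adj t v ∧ y t ≠ b := by
        rw [h.reach_summand_iff htop hL hti] at hnr
        by_contra hcon
        exact hnr ⟨htv, hyz, fun h1 => by_contra fun h2 => hcon ⟨h1, h2⟩⟩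
      -- below the other summand, a different copy of the sum node of `t` skips the same node
      let z' : ∀ v, Val v := Function.update (fun q => if q < u then x q else y q) u a'
      have hz : ∀ q, q < u → z' q = x q := by
        intro q hq
        simp [z', Function.update_of_ne hq.ne, hq]
      have hz' : ∀ q, u < q → z' q = y q := by
        intro q hq
        simp [z', Function.update_of_ne hq.ne', hq.le]
      refine ⟨sumNode B.dag t z', R t z' b, (h.reach_summand_iff htop hL hu).2
        ⟨hut, fun q _ hq => hz q hq, fun _ => Function.update_self _ _ _⟩,
        h.isSum_sumNode hti z', (h.isChild_sumNode hti).2 ⟨b, rfl⟩, ht,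
        (h.isAncestor_sumNode_iff htop hL hti).2 ⟨htv, fun q hq hqt => ?_⟩, fun hr' => ?_⟩
      · rcases lt_trichotomy q u with hqu | rfl | hqu
        · rw [hyx q hq hqu, hz q hqu]
        · exact absurd hq hadj
        · exact (hz' q hqu).symm
      · exact htb.2 (((h.reach_summand_iff htop hL hti).1 hr').2.2 htb.1)
  · rintro ⟨hanc, hadj⟩
    obtain ⟨huv, hyx⟩ := (h.isAncestor_sumNode_iff htop hL hu).1 hanc
    have := hval u hu
    obtain ⟨b, hb⟩ := exists_ne (y u)
    refine Circuit.isConditioning_of_reach hs ((h.isChild_sumNode hu).2 ⟨y u, rfl⟩)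
      ((h.isChild_sumNode hu).2 ⟨b, rfl⟩)
      ((h.reach_summand_iff htop hL hu).2 ⟨huv, hyx, fun _ => rfl⟩) fun hr => ?_
    exact hb (((h.reach_summand_iff htop hL hu).1 hr).2.2 hadj).symm

theorem reach_sumNode_indicator_iff (htop : B.IsTopological) (h : IsUnrolled B M R w L C)
    (hL : AllTerminal B L) {u v : V} (hv : B.Internal v) (hM : v ∉ M) {x : ∀ v, Val v}
    {b : Val v} :
    C.Reach (sumNode B.dag u x) (.indicator v b) ↔ ReflTransGen (ElimChild B.dag) u v := by
  constructor
  · intro hr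
    induction u using WellFoundedGT.induction generalizing x with
    | ind u ih =>
      rcases h.reach_sumNode_cases hL hr with he | ⟨hu, a, hr⟩
      · exact absurd he.symm sumNode_ne_indicator
      · rcases h.reach_summand_cases hu hr with he | ⟨c, hc, hr⟩ | ⟨-, he⟩
        · exact absurd he.symm (h.summand_ne_indicator hu hM)
        · exact .head hc (ih c hc.1 hr)
        · obtain rfl := (ACNode.indicator.inj he).1
          exact .refl
  · intro huv
    exact ((h.reach_sumNode_self htop huv x).tail ((h.isChild_sumNode hv).2 ⟨b, rfl⟩)).tail
      ((h.isChild_summand hv).2 (Or.inr ⟨hM, rfl⟩))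

theorem reach_summand_indicator_of_transGen (htop : B.IsTopological)
    (h : IsUnrolled B M R w L C) (hL : AllTerminal B L) {u v : V} (hu : B.Internal u)
    (hv : B.Internal v) (hM : v ∉ M) {x : ∀ v, Val v} {a : Val u} {b : Val v}
    (huv : TransGen (ElimChild B.dag) u v) : C.Reach (R u x a) (.indicator v b) := by
  obtain ⟨c, hc, hcv⟩ := TransGen.head'_iff.1 huv
  exact .head ((h.isChild_summand hu).2 (Or.inl ⟨c, hc, rfl⟩))
    ((h.reach_sumNode_indicator_iff htop hL hv hM).2 hcv)

theorem reach_summand_indicator_self (htop : B.IsTopological) (h : IsUnrolled B M R w L C)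
    (hL : AllTerminal B L) {v : V} (hv : B.Internal v) (hM : v ∉ M) {x : ∀ v, Val v}
    {a b : Val v} : C.Reach (R v x a) (.indicator v b) ↔ a = b := by
  constructor
  · intro hr
    rcases h.reach_summand_cases hv hr with he | ⟨c, hc, hr⟩ | ⟨-, he⟩
    · exact absurd he.symm (h.summand_ne_indicator hv hM)
    · have hcv := (h.reach_sumNode_indicator_iff htop hL hv hM).1 hr
      exact absurd (lt_of_transGen_elimChild (.head' hc hcv)) (lt_irrefl v)
    · exact (eq_of_heq (ACNode.indicator.inj he).2).symm
  · rintro rfl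
    exact .single ((h.isChild_summand hv).2 (Or.inr ⟨hM, rfl⟩))

/-- An indicator of an internal variable hangs on the sum nodes of its own variable only: every
other sum node above it reaches all of the indicators of the variable through each child. -/
theorem isConditioning_indicator_iff (htop : B.IsTopological)
    (hval : ∀ v, B.Internal v → Nontrivial (Val v)) (h : IsUnrolled B M R w L C)
    (hL : AllTerminal B L) {u v : V} (hu : B.Internal u) (hv : B.Internal v) (hM : v ∉ M)
    {x : ∀ v, Val v} {b : Val v} :
    C.IsConditioning (sumNode B.dag u x) (.indicator v b) ↔ u = v := by
  constructor
  · intro hcond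
    by_contra huv
    have hr := (h.reach_sumNode_indicator_iff htop hL hv hM).1 hcond.2.1.to_reflTransGen
    have huv' := (reflTransGen_iff_eq_or_transGen.1 hr).resolve_left fun h' => huv h'.symm
    refine Circuit.not_isConditioning_of_reach (fun c hc => ?_) ?_ hcond
    · obtain ⟨a, rfl⟩ := (h.isChild_sumNode hu).1 hc
      exact h.reach_summand_indicator_of_transGen htop hL hu hv hM huv'
    · -- a leaf has no twin
      rintro c c' - - s' e - ⟨-, -, ⟨ch, hch⟩, -⟩
      rw [h.indicator_op v b hM] at hch
      cases hch
  · rintro rfl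
    have := hval u hu
    obtain ⟨a, ha⟩ := exists_ne b
    exact Circuit.isConditioning_of_reach (h.isSum_sumNode hu x)
      ((h.isChild_sumNode hu).2 ⟨b, rfl⟩) ((h.isChild_sumNode hu).2 ⟨a, rfl⟩)
      ((h.reach_summand_indicator_self htop hL hu hM).2 rfl)
      fun hr => ha ((h.reach_summand_indicator_self htop hL hu hM).1 hr)

/-! ### The sum-regions of the compiled network -/

theorem pathSums_cases (h : IsUnrolled B M R w L C) (hL : AllTerminal B L) {k : ℕ}
    {n : ACNode Val B.dag} (hn : C.PathSums k n) :
    n = C.root ∧ k = 0 ∨ (∃ v x, n = sumNode B.dag v x ∧ k = elimDepth B.dag v) ∨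
      (∃ v x a, B.Internal v ∧ n = R v x a ∧ k = elimDepth B.dag v + 1) ∨
      ∃ v a, v ∉ M ∧ n = .indicator v a := by
  induction hn with
  | root => exact Or.inl ⟨rfl, rfl⟩
  | sum _ hs hc ih =>
    rcases ih with ⟨rfl, -⟩ | ⟨v, x, rfl, rfl⟩ | ⟨v, x, a, hv, rfl, -⟩ | ⟨v, a, hM, rfl⟩
    · exact absurd h.isProd_root (Circuit.not_isProd_of_isSum hs)
    · by_cases hv : B.Internal v
      · obtain ⟨a, rfl⟩ := (h.isChild_sumNode hv).1 hc
        exact Or.inr (Or.inr (Or.inl ⟨v, x, a, hv, rfl, rfl⟩))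
      · exact absurd hc (h.not_isChild_leaf hL hv)
    · exact absurd (h.isProd_summand hv x a) (Circuit.not_isProd_of_isSum hs)
    · exact absurd hc (h.not_isChild_indicator hM)
  | prod _ hp hc ih =>
    rcases ih with ⟨rfl, rfl⟩ | ⟨v, x, rfl, -⟩ | ⟨v, x, a, hv, rfl, rfl⟩ | ⟨v, a, hM, rfl⟩
    · obtain ⟨r, hr, rfl⟩ := h.isChild_root.1 hc
      exact Or.inr (Or.inl ⟨r, _, rfl, (elimDepth_eq_zero hr).symm⟩)
    · exact absurd hp (h.not_isProd_sumNode hL v x)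
    · rcases (h.isChild_summand hv).1 hc with ⟨d, hd, rfl⟩ | ⟨hM, rfl⟩
      · exact Or.inr (Or.inl ⟨d, _, rfl, (elimDepth_of_elimChild hd).symm⟩)
      · exact Or.inr (Or.inr (Or.inr ⟨v, a, hM, rfl⟩))
    · exact absurd hc (h.not_isChild_indicator hM)

theorem sumDepth_sumNode (htop : B.IsTopological) (h : IsUnrolled B M R w L C)
    (hL : AllTerminal B L) (v : V) (x : ∀ v, Val v) :
    C.sumDepth (sumNode B.dag v x) = elimDepth B.dag v := by
  refine Circuit.sumDepth_eq (h.live_sumNode htop v x) fun k hk => ?_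
  rcases h.pathSums_cases hL hk with ⟨he, -⟩ | ⟨u, y, he, rfl⟩ | ⟨u, y, a, hu, he, -⟩ |
    ⟨u, a, -, he⟩
  · exact absurd (he ▸ h.isProd_root) (h.not_isProd_sumNode hL v x)
  · rw [eq_of_sumNode_eq he]
  · exact absurd he.symm (h.summand_ne_sumNode hL hu)
  · exact absurd he sumNode_ne_indicator

theorem inScope_sumNode_iff (htop : B.IsTopological) (hM : ∀ v ∈ M, B.Internal v)
    (h : IsUnrolled B M R w L C) (hL : AllTerminal B L) {u v : V} {x : ∀ v, Val v} :
    C.InScope u (sumNode B.dag v x) ↔ ReflTransGen (ElimChild B.dag) v u ∧ u ∉ M := by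
  rw [Circuit.inScope_iff]
  constructor
  · rintro ⟨m, hr, hm⟩
    rcases h.isLeafOf_cases hL ((h.live_sumNode htop v x).trans hr) hm with
      ⟨hu, y, rfl⟩ | ⟨hu, huM, a, rfl⟩
    · exact ⟨(h.of_reach_sumNode htop hL hr).1, fun h' => hu (hM u h')⟩
    · exact ⟨(h.reach_sumNode_indicator_iff htop hL hu huM).1 hr, huM⟩
  · rintro ⟨hvu, huM⟩
    by_cases hu : B.Internal u
    · exact ⟨.indicator u (Classical.arbitrary _),
        (h.reach_sumNode_indicator_iff htop hL hu huM).2 hvu, h.isLeafOf_indicator huM _⟩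
    · exact ⟨_, h.reach_sumNode_self htop hvu x, h.isLeafOf_sumNode hL hu x⟩

/-- The sum-regions are the internal variables: variables at the same depth of the elimination forest have
disjoint non-empty scopes. -/
theorem sumRegion_sumNode (htop : B.IsTopological) (hM : ∀ v ∈ M, B.Internal v)
    (h : IsUnrolled B M R w L C) (hL : AllTerminal B L) {v : V} (hv : B.Internal v)
    (x : ∀ v, Val v) : C.sumRegion (sumNode B.dag v x) = Set.range (sumNode B.dag v) := by
  ext t
  constructor
  · rintro ⟨hl, hs, hd, hscope⟩
    obtain ⟨u, y, hu, rfl⟩ := h.isSum_cases hL hl hs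
    rw [h.sumDepth_sumNode htop hL, h.sumDepth_sumNode htop hL] at hd
    obtain ⟨l, hvl, hli⟩ := exists_leaf_of_elimForest htop v
    have hul := (hscope l).2 ((h.inScope_sumNode_iff htop hM hL).2 ⟨hvl, fun h' => hli (hM l h')⟩)
    obtain rfl := eq_of_elimDepth_eq ((h.inScope_sumNode_iff htop hM hL).1 hul).1 hvl hd
    exact ⟨y, rfl⟩
  · rintro ⟨y, rfl⟩
    refine ⟨h.live_sumNode htop v y, h.isSum_sumNode hv y, ?_, fun u => ?_⟩
    · rw [h.sumDepth_sumNode htop hL, h.sumDepth_sumNode htop hL]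
    · rw [h.inScope_sumNode_iff htop hM hL, h.inScope_sumNode_iff htop hM hL]

theorem exists_latent_eq (htop : B.IsTopological) (hM : ∀ v ∈ M, B.Internal v)
    (h : IsUnrolled B M R w L C) (hL : AllTerminal B L) (Z : C.Latent) :
    ∃ v, B.Internal v ∧ Z.1 = Set.range (sumNode B.dag v) := by
  obtain ⟨s, hl, hs, hZ⟩ := Z.2
  obtain ⟨v, x, hv, rfl⟩ := h.isSum_cases hL hl hs
  exact ⟨v, hv, hZ.trans (h.sumRegion_sumNode htop hM hL hv x)⟩

theorem exists_latent (htop : B.IsTopological) (hM : ∀ v ∈ M, B.Internal v)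
    (h : IsUnrolled B M R w L C) (hL : AllTerminal B L) {v : V} (hv : B.Internal v) :
    ∃ Z : C.Latent, Z.1 = Set.range (sumNode B.dag v) := by
  let x : ∀ v, Val v := fun v => Classical.arbitrary _
  exact ⟨⟨Set.range (sumNode B.dag v), sumNode B.dag v x, h.live_sumNode htop v x,
    h.isSum_sumNode hv x, (h.sumRegion_sumNode htop hM hL hv x).symm⟩, rfl⟩

theorem range_observed (htop : B.IsTopological) (hM : ∀ v ∈ M, B.Internal v)
    (h : IsUnrolled B M R w L C) (hL : AllTerminal B L) :
    (Set.range fun X : C.Observed => X.1) = Mᶜ := by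
  ext v
  constructor
  · rintro ⟨⟨u, n, hl, hn⟩, rfl⟩
    rcases h.isLeafOf_cases hL hl hn with ⟨hu, -⟩ | ⟨-, huM, -⟩
    · exact fun h' => hu (hM u h')
    · exact huM
  · intro hv
    let x : ∀ v, Val v := fun v => Classical.arbitrary _
    by_cases hi : B.Internal v
    · exact ⟨⟨v, _, h.live_indicator htop hi hv (x v), h.isLeafOf_indicator hv _⟩, rfl⟩
    · exact ⟨⟨v, _, h.live_sumNode htop v x, h.isLeafOf_sumNode hL hi x⟩, rfl⟩

/-! ### The edges of the decompiled network -/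

/-- A latent variable and a variable whose nodes are the table entries of `v` are adjacent if and
only if their names are adjacent in the moral closure. -/
theorem adj_iff_of_represents (htop : B.IsTopological)
    (hval : ∀ v, B.Internal v → Nontrivial (Val v)) (h : IsUnrolled B M R w L C)
    (hL : AllTerminal B L) {u v : V} (hu : B.Internal u) {Z : C.Latent}
    (hZ : Z.1 = Set.range (sumNode B.dag u)) {b : C.Latent ⊕ C.Observed}
    (hb : ∀ n, C.Represents n b ↔ n ∈ Set.range (sumNode B.dag v)) :
    (SPN2BN C).Adj (.inl Z) b ↔ (moralClosure B.dag).Adj u v := by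
  rw [Circuit.adj_inl_iff, hZ]
  constructor
  · rintro ⟨s, n, ⟨x, rfl⟩, hn, hc⟩
    obtain ⟨y, rfl⟩ := (hb n).1 hn
    exact ((h.isConditioning_sumNode_iff htop hval hL hu).1 hc).2
  · intro hadj
    let x : ∀ v, Val v := fun v => Classical.arbitrary _
    refine ⟨sumNode B.dag u x, sumNode B.dag v x, ⟨x, rfl⟩, (hb _).2 ⟨x, rfl⟩,
      (h.isConditioning_sumNode_iff htop hval hL hu).2 ⟨?_, hadj⟩⟩
    exact (h.isAncestor_sumNode_iff htop hL hu).2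
      ⟨transGen_elimChild_of_adj htop hadj, fun _ _ _ => rfl⟩

theorem represents_inr_iff (htop : B.IsTopological) (h : IsUnrolled B M R w L C)
    (hL : AllTerminal B L) {X : C.Observed} (hX : ¬ B.Internal X.1) (n : ACNode Val B.dag) :
    C.Represents n (.inr X) ↔ n ∈ Set.range (sumNode B.dag X.1) := by
  constructor
  · rintro ⟨hl, hn⟩
    rcases h.isLeafOf_cases hL hl hn with ⟨-, x, rfl⟩ | ⟨hi, -⟩
    · exact ⟨x, rfl⟩
    · exact absurd hi hX
  · rintro ⟨x, rfl⟩
    exact ⟨h.live_sumNode htop _ x, h.isLeafOf_sumNode hL hX x⟩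

theorem adj_inr_iff_of_internal (htop : B.IsTopological)
    (hval : ∀ v, B.Internal v → Nontrivial (Val v)) (h : IsUnrolled B M R w L C)
    (hL : AllTerminal B L) {u : V} (hu : B.Internal u) {Z : C.Latent}
    (hZ : Z.1 = Set.range (sumNode B.dag u)) {X : C.Observed} (hX : B.Internal X.1) :
    (SPN2BN C).Adj (.inl Z) (.inr X) ↔ u = X.1 := by
  have key : ∀ n, C.Live n → C.IsLeafOf X.1 n → X.1 ∉ M ∧ ∃ a, n = .indicator X.1 a := by
    intro n hl hn
    rcases h.isLeafOf_cases hL hl hn with ⟨hi, -⟩ | ⟨-, hM, ha⟩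
    · exact absurd hX hi
    · exact ⟨hM, ha⟩
  rw [Circuit.adj_inl_iff, hZ]
  constructor
  · rintro ⟨s, n, ⟨x, rfl⟩, ⟨hl, hn⟩, hc⟩
    obtain ⟨hM, a, rfl⟩ := key n hl hn
    exact (h.isConditioning_indicator_iff htop hval hL hu hX hM).1 hc
  · intro he
    obtain ⟨n, hl, hn⟩ := X.2
    obtain ⟨hM, a, rfl⟩ := key n hl hn
    exact ⟨_, _, ⟨fun v => Classical.arbitrary _, rfl⟩, ⟨hl, hn⟩,
      (h.isConditioning_indicator_iff htop hval hL hu hX hM).2 he⟩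

end IsUnrolled

end Decompilation

end SPN

/-! ### The decompilation recovers the moral closure -/

theorem mainTheorem1 {V : Type*} [Fintype V] [LinearOrder V] {Val : V → Type*}
    [∀ v, Fintype (Val v)] [∀ v, Nonempty (Val v)]
    (B : SPN.BayesNet V Val) (htop : B.IsTopological)
    (hval : ∀ v, B.Internal v → Nontrivial (Val v))
    (M : Set V) (hM : ∀ v ∈ M, B.Internal v) :
    (∃ S, SPN.BN2SPN B M S) ∧
    ∀ S, SPN.BN2SPN B M S →
      ∃ f : S.Latent ⊕ S.Observed → V,
        -- `f` names the variables of the output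
        (∀ X : S.Observed, f (.inr X) = X.1) ∧
        (∀ (Z : S.Latent) (v : V) (g : Val v → SPN.ACNode Val B.dag),
          SPN.ACNode.sumOver v g ∈ Z.1 → f (.inl Z) = v) ∧
        -- if all internal variables are marginalized, the output is the moral closure
        (M = {v | B.Internal v} →
          Function.Bijective f ∧
          ∀ a b, (SPN.SPN2BN S).Adj a b ↔ (SPN.moralClosure B.dag).Adj (f a) (f b)) ∧
        -- in general, it is the moral closure after identification of variables with one name
        Function.Surjective f ∧
        (∀ u v, (SPN.moralClosure B.dag).Adj u v ↔
          u ≠ v ∧ ∃ a b, f a = u ∧ f b = v ∧ (SPN.SPN2BN S).Adj a b) ∧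
        -- precisely, it is the moral closure on the latent variables and the childless variables,
        -- and every internal variable that is not marginalized hangs on its latent copy
        (Set.range fun X : S.Observed => X.1) = Mᶜ ∧
        (Function.Injective fun Z : S.Latent => f (.inl Z)) ∧
        (Set.range fun Z : S.Latent => f (.inl Z)) = {v | B.Internal v} ∧
        (∀ Z Z' : S.Latent, (SPN.SPN2BN S).Adj (.inl Z) (.inl Z') ↔
          (SPN.moralClosure B.dag).Adj (f (.inl Z)) (f (.inl Z'))) ∧
        (∀ (Z : S.Latent) (X : S.Observed), ¬ B.Internal X.1 →
          ((SPN.SPN2BN S).Adj (.inl Z) (.inr X) ↔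
            (SPN.moralClosure B.dag).Adj (f (.inl Z)) X.1)) ∧
        (∀ (Z : S.Latent) (X : S.Observed), B.Internal X.1 →
          ((SPN.SPN2BN S).Adj (.inl Z) (.inr X) ↔ f (.inl Z) = X.1)) ∧
        (∀ (X : S.Observed) (b : S.Latent ⊕ S.Observed), ¬ (SPN.SPN2BN S).Adj (.inr X) b) := by
  refine ⟨SPN.exists_BN2SPN B htop hM, fun S hS => ?_⟩
  obtain ⟨R, w, L, h, hL⟩ := SPN.isUnrolled_of_BN2SPN B htop hM hS
  choose name hname hregion using h.exists_latent_eq htop hM hL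
  have hmem : ∀ Z v x, SPN.sumNode B.dag v x ∈ Z.1 → name Z = v := by
    intro Z v x hx
    rw [hregion] at hx
    obtain ⟨y, hy⟩ := hx
    exact SPN.eq_of_sumNode_eq hy
  have hlatent : ∀ v, B.Internal v → ∃ Z, name Z = v := by
    intro v hv
    obtain ⟨Z, hZ⟩ := h.exists_latent htop hM hL hv
    exact ⟨Z, hmem Z v (fun v => Classical.arbitrary _) (hZ ▸ ⟨_, rfl⟩)⟩
  have hinj : Function.Injective name := by
    intro Z Z' he
    refine Subtype.ext ?_
    rw [hregion Z, hregion Z', he]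
  have hobs := h.range_observed htop hM hL
  have hobs' : ∀ v, ¬ B.Internal v → ∃ X : S.Observed, X.1 = v := fun v hv =>
    (Set.ext_iff.1 hobs v).2 fun h' => hv (hM v h')
  have hadj_inl : ∀ Z Z', (SPN.SPN2BN S).Adj (.inl Z) (.inl Z') ↔
      (SPN.moralClosure B.dag).Adj (name Z) (name Z') := fun Z Z' =>
    h.adj_iff_of_represents htop hval hL (hname Z) (hregion Z)
      fun n => by rw [← hregion Z']; rfl
  have hadj_leaf : ∀ Z (X : S.Observed), ¬ B.Internal X.1 →
      ((SPN.SPN2BN S).Adj (.inl Z) (.inr X) ↔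
        (SPN.moralClosure B.dag).Adj (name Z) X.1) := fun Z X hX =>
    h.adj_iff_of_represents htop hval hL (hname Z) (hregion Z) (h.represents_inr_iff htop hL hX)
  have hadj_internal : ∀ Z (X : S.Observed), B.Internal X.1 →
      ((SPN.SPN2BN S).Adj (.inl Z) (.inr X) ↔ name Z = X.1) := fun Z X hX =>
    h.adj_inr_iff_of_internal htop hval hL (hname Z) (hregion Z) hX
  have hsurj : Function.Surjective (Sum.elim name fun X : S.Observed => X.1) := by
    intro v
    by_cases hv : B.Internal v
    · obtain ⟨Z, hZ⟩ := hlatent v hv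
      exact ⟨.inl Z, hZ⟩
    · obtain ⟨X, hX⟩ := hobs' v hv
      exact ⟨.inr X, hX⟩
  refine ⟨Sum.elim name fun X => X.1, fun _ => rfl, ?_, ?_, hsurj, ?_, hobs, hinj, ?_, hadj_inl,
    hadj_leaf, hadj_internal, fun X b => SPN.Circuit.not_adj_inr⟩
  · intro Z v g hg
    rw [hregion Z] at hg
    obtain ⟨x, hx⟩ := hg
    rw [SPN.sumNode_eq] at hx
    exact (SPN.ACNode.sumOver.inj hx).1
  · rintro rfl
    have hX : ∀ X : S.Observed, ¬ B.Internal X.1 := fun X => (Set.ext_iff.1 hobs X.1).1 ⟨X, rfl⟩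
    refine ⟨⟨?_, hsurj⟩, ?_⟩
    · rintro (Z | X) (Z' | X') he
      · exact congrArg Sum.inl (hinj he)
      · have he' : name Z = X'.1 := he
        exact absurd (he' ▸ hname Z) (hX X')
      · have he' : X.1 = name Z' := he
        exact absurd (he' ▸ hname Z') (hX X)
      · exact congrArg Sum.inr (Subtype.ext he)
    · rintro (Z | X) b
      · rcases b with Z' | X
        · exact hadj_inl Z Z'
        · exact hadj_leaf Z X (hX X)
      · exact iff_of_false SPN.Circuit.not_adj_inr
          fun hadj => hX X (SPN.exists_adj_of_moralClosure hadj)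
  · intro u v
    constructor
    · intro hadj
      refine ⟨(SPN.moralClosure_lt htop hadj).ne, ?_⟩
      obtain ⟨Z, rfl⟩ := hlatent u (SPN.exists_adj_of_moralClosure hadj)
      by_cases hv : B.Internal v
      · obtain ⟨Z', rfl⟩ := hlatent v hv
        exact ⟨.inl Z, .inl Z', rfl, rfl, (hadj_inl Z Z').2 hadj⟩
      · obtain ⟨X, rfl⟩ := hobs' v hv
        exact ⟨.inl Z, .inr X, rfl, rfl, (hadj_leaf Z X hv).2 hadj⟩
    · rintro ⟨hne, a, b, rfl, rfl, hadj⟩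
      rcases a with Z | X
      · rcases b with Z' | X
        · exact (hadj_inl Z Z').1 hadj
        · by_cases hX : B.Internal X.1
          · exact absurd ((hadj_internal Z X hX).1 hadj) hne
          · exact (hadj_leaf Z X hX).1 hadj
      · exact absurd hadj SPN.Circuit.not_adj_inr
  · ext v
    exact ⟨fun ⟨Z, hZ⟩ => hZ ▸ hname Z, hlatent v⟩
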